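/- Let $N\ge 1$, let $y_1,\dots,y_N\in\mathbb R^2$ be distinct, $Y=\{y_1,\dots,y_N\}$, and let $\alpha=(\alpha_1,\dots,\alpha_N)\in\mathbb R^N$. For $\operatorname{Im}z>0$ let $\mathcal G_z(x)=\frac i4H^{(1)}_0(z|x|)$ be the convolution kernel of $(-\Delta-z^2)^{-1}$ on $\mathbb R^2$, where $H_0^{(1)}$ is the Hankel function of the first kind, let $g(z)=-\frac1{2\pi}\log\frac z2+\frac i4-\frac\gamma{2\pi}$ with Euler's constant $\gamma$ and the principal logarithm, and let $\Gamma(z)$ be the $N\times N$ matrix with entries $\Gamma(z)_{jj}=\alpha_j-g(z)$ and $\Gamma(z)_{jk}=-\mathcal G_z(y_j-y_k)$ for $j\ne k$. When $\Gamma(z)$ is invertible, put, for $f\in L^2(\mathbb R^2)$, $$R(z^2)f(x)=\int\mathcal G_z(x-y)f(y)\,dy+\sum_{j,k=1}^N[\Gamma(z)^{-1}]_{jk}\,\mathcal G_z(x-y_j)\int\mathcal G_z(y-y_k)f(y)\,dy ,$$ the resolvent at $z^2$ of the Schrödinger operator $H_{\alpha,Y}$ with point interactions. For $s\in\mathbb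 R$ let $L^2_{s}(\mathbb R^2)$ be the space of all $u$ with $\langle x\rangle^{s}u\in L^2(\mathbb R^2)$, normed by $\|\langle x\rangle^{s}u\|_{L^2}$, where $\langle x\rangle=(1+|x|^2)^{1/2}$. Let $1<\sigma<2$, let $R_{-\sigma}(z^2)$ be the extension of $R(z^2)$ by continuity to $L^2_{-\sigma}(\mathbb R^2)$ (the closure of its graph in $L^2_{-\sigma}\times L^2_{-\sigma}$), and let $H^{-\sigma}_{\alpha,Y}$ be the operator in $L^2_{-\sigma}(\mathbb R^2)$ whose resolvent at $z^2$ is $R_{-\sigma}(z^2)$; that is, $H^{-\sigma}_{\alpha,Y}u=f$ means that $u,f\in L^2_{-\sigma}$ and $R_{-\sigma}(z^2)(f-z^2u)=u$. Let $\tilde D$ be the real symmetric matrix with $\tilde D_{jj}=\alpha_j$ and $\tilde D_{jk}=\frac1{2\pi}\log|y_j-y_k|$ for $j\neq k$, let $\mathbf 1=(1,\dots,1)\in\mathbb C^N$, and let $S=1-P$, where $P$ is the orthogonal projection of $\mathbb C^N$ onto $\mathbb C\mathbf 1$. Write $\langle a,b\rangle=\sum_j a_jb_j$ (without complex conjugation).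 Then, for every $1<\sigma<2$ and every $z$ with $\operatorname{Im}z>0$ and $\Gamma(z)$ invertible, as sets of measurable functions modulo equality almost everywhere, $$\operatorname{Ker}H^{-\sigma}_{\alpha,Y}=\Big\{\varphi(x)=\frac{\langle\tilde D a,\mathbf 1\rangle}{N}-\frac1{2\pi}\sum_{j=1}^N a_j\log|x-y_j|\ :\ a=(a_1,\dots,a_N)\in\mathbb C^N,\ S\tilde D a=0\Big\}.$$ In particular the null space does not depend on $\sigma\in(1,2)$ nor on the choice of $z$. -/

import Mathlib

open MeasureTheory Filter Topology

noncomputable section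

namespace PointInteraction

/-- The plane with its Euclidean norm. -/
abbrev Plane : Type := EuclideanSpace ℝ (Fin 2)

/-- Complex valued measurable functions on the plane modulo equality almost everywhere. -/
abbrev Fn : Type := Plane →ₘ[(volume : Measure Plane)] ℂ

/-- `(i/4) H₀⁽¹⁾(w)` for `Im w > 0`, where `H₀⁽¹⁾` is the Hankel function of the first kind, by the
integral formula `e^{iw} / (2^{3/2} π) ∫_0^∞ e^{-t} t^{-1/2} (t/2 - iw)^{-1/2} dt`
(principal branch, `Re (t/2 - iw) > 0`). -/
def hankelKernel (w : ℂ) : ℂ :=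
  Complex.exp (Complex.I * w) / (((2 : ℝ) ^ (3 / 2 : ℝ) * Real.pi : ℝ) : ℂ) *
    ∫ t in Set.Ioi (0 : ℝ),
      ((Real.exp (-t) * t ^ (-(1 / 2) : ℝ) : ℝ) : ℂ) *
        ((t : ℂ) / 2 - Complex.I * w) ^ (-(1 / 2) : ℂ)

/-- The convolution kernel of the free resolvent `(-Δ - z²)⁻¹`, `Im z > 0`, off the origin. -/
def freeKernel (z : ℂ) (x : Plane) : ℂ := hankelKernel (z * (‖x‖ : ℂ))

/-- `g(z) = -(2π)⁻¹ log (z/2) + i/4 - γ/(2π)`, `γ` being Euler's constant. -/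
def g (z : ℂ) : ℂ :=
  -(1 / (2 * (Real.pi : ℂ))) * Complex.log (z / 2) + Complex.I / 4
    - (Real.eulerMascheroniConstant : ℂ) / (2 * (Real.pi : ℂ))

variable {N : ℕ}

/-- The matrix `Γ_{α,Y}(z)`. -/
def Gam (α : Fin N → ℝ) (Y : Fin N → Plane) (z : ℂ) : Matrix (Fin N) (Fin N) ℂ :=
  Matrix.of fun j k => if j = k then (α j : ℂ) - g z else -freeKernel z (Y j - Y k)

/-- The real symmetric matrix `D̃`, acting on `ℂ^N`. -/
def Dt (α : Fin N → ℝ) (Y : Fin N → Plane) : Matrix (Fin N) (Fin N) ℂ :=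
  Matrix.of fun j k =>
    if j = k then (α j : ℂ) else ((1 / (2 * Real.pi) * Real.log ‖Y j - Y k‖ : ℝ) : ℂ)

/-- The orthogonal projection `P = e ⊗ e` of `ℂ^N` onto the span of `e = N^{-1/2} (1, …, 1)`. -/
def P (N : ℕ) : Matrix (Fin N) (Fin N) ℂ :=
  Matrix.vecMulVec (fun _ => (((Real.sqrt N)⁻¹ : ℝ) : ℂ)) (fun _ => (((Real.sqrt N)⁻¹ : ℝ) : ℂ))

/-- The complementary projection `S = 1 - P`. -/
def S (N : ℕ) : Matrix (Fin N) (Fin N) ℂ := 1 - P N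

/-- The resolvent `R(z²)` of the point interaction Hamiltonian on `L²`: free resolvent plus the
finite rank term `∑_{j,k} [Γ(z)⁻¹]_{jk} G_z(x - y_j) ∫ G_z(y - y_k) f(y) dy`. -/
def resolventFun (α : Fin N → ℝ) (Y : Fin N → Plane) (z : ℂ) (f : Plane → ℂ) (x : Plane) : ℂ :=
  (∫ y, freeKernel z (x - y) * f y) +
    ∑ j, ∑ k, (Gam α Y z)⁻¹ j k * freeKernel z (x - Y j) * ∫ y, freeKernel z (y - Y k) * f y

/-- `⟨x⟩^s u(x)` with `⟨x⟩ = (1 + |x|²)^{1/2}`. -/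
def weighted (s : ℝ) (u : Plane → ℂ) (x : Plane) : ℂ :=
  ((Real.sqrt (1 + ‖x‖ ^ 2) ^ s : ℝ) : ℂ) * u x

/-- Membership in the weighted space `L²_s`, that is, `⟨x⟩^s u ∈ L²`. -/
def MemWeightedL2 (s : ℝ) (u : Plane → ℂ) : Prop := MemLp (weighted s u) 2 volume

/-- The norm of `L²_s`. -/
def weightedNorm (s : ℝ) (u : Plane → ℂ) : ENNReal := eLpNorm (weighted s u) 2 volume

/-- The graph of the extension by continuity `R_{-σ}(z²)` of `R(z²)` from `L²` to `L²_{-σ}`: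
`R_{-σ}(z²) f = u` means that `f` and `u` belong to `L²_{-σ}` and that some sequence `fₙ` in `L²`
satisfies `fₙ → f` and `R(z²) fₙ → u` in `L²_{-σ}`. -/
def ExtendedResolvent (α : Fin N → ℝ) (Y : Fin N → Plane) (σ : ℝ) (z : ℂ) (f u : Fn) : Prop :=
  MemWeightedL2 (-σ) f ∧ MemWeightedL2 (-σ) u ∧
    ∃ fn : ℕ → Plane → ℂ, (∀ n, MemLp (fn n) 2 volume) ∧
      Tendsto (fun n => weightedNorm (-σ) (fun x => fn n x - f x)) atTop (𝓝 0) ∧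
      Tendsto (fun n => weightedNorm (-σ) (fun x => resolventFun α Y z (fn n) x - u x))
        atTop (𝓝 0)

/-- The graph of `H^{-σ}_{α,Y}`, the operator in `L²_{-σ}` whose resolvent at `z²` is
`R_{-σ}(z²)`: `H u = f` means that `u, f ∈ L²_{-σ}` and `R_{-σ}(z²) (f - z² u) = u`. -/
def weightedH (α : Fin N → ℝ) (Y : Fin N → Plane) (σ : ℝ) (z : ℂ) (u f : Fn) : Prop :=
  MemWeightedL2 (-σ) u ∧ MemWeightedL2 (-σ) f ∧ ExtendedResolvent α Y σ z (f - z ^ 2 • u) u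

/-- The null space of `H^{-σ}_{α,Y}`. -/
def nullSpace (α : Fin N → ℝ) (Y : Fin N → Plane) (σ : ℝ) (z : ℂ) : Set Fn :=
  {u | weightedH α Y σ z u 0}

/-- `⟨D̃ a, 1⟩ / N - (2π)⁻¹ ∑_j a_j log |x - y_j|`. -/
def phiFun (α : Fin N → ℝ) (Y : Fin N → Plane) (a : Fin N → ℂ) (x : Plane) : ℂ :=
  (∑ j, (Dt α Y).mulVec a j) / (N : ℂ)
    - 1 / (2 * (Real.pi : ℂ)) * ∑ j, a j * ((Real.log ‖x - Y j‖ : ℝ) : ℂ)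

theorem phiFun_aestronglyMeasurable (α : Fin N → ℝ) (Y : Fin N → Plane) (a : Fin N → ℂ) :
    AEStronglyMeasurable (phiFun α Y a) volume := by
  apply Measurable.aestronglyMeasurable
  unfold phiFun
  fun_prop

/-- The class of `phiFun` modulo equality almost everywhere. -/
def phi (α : Fin N → ℝ) (Y : Fin N → Plane) (a : Fin N → ℂ) : Fn :=
  AEEqFun.mk (phiFun α Y a) (phiFun_aestronglyMeasurable α Y a)

end PointInteraction

end

/-!
Write `G` for the free kernel, `E = -(2π)⁻¹ log |x|` for the logarithmic potential and `f * g` for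
convolution. The proof rests on two facts about the pair `G`, `E` and on a Liouville theorem.

*The kernel.* With `q = -iz`, the substitution `t = rτ` turns the integral formula for `H₀⁽¹⁾` into
a Laplace transform in the radius, `G(x) = (2π)⁻¹ ∫₀^∞ e^{-|x| (τ + q)} dτ / √((τ + q)² - q²)`
(`hankelKernel_eq_laplace`). By Fubini, a radial moment of `G` is an integral over `τ` of an
elementary Laplace transform, and for the moments of `1`, `log r` and `log⁺ (r / ρ)` this integrand
is a total derivative in `τ`. Since the mean of `log |x - y|` over the circle `|y| = r` is
`log (max |x| r)`, these moments give `-z² G * 1 = 1`, `-z² G * E = E - G` off the origin, and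
`-z² (G * E)(0) = -g(z)` (`integral_freeKernel`, `conv_freeKernel_logKernel`,
`conv_freeKernel_logKernel_zero`).

*Liouville.* Let `w ∈ L²_{-σ}` with `w = -z² G * w`. For a radial probability density `k` of compact
support, `Φ = E - k * E` has compact support, and convolving `-z² G * E = E - G` with `δ - k` gives
`G - k * G = Φ + z² G * Φ`. Convolving this with `w` yields `k * w = w`
(`conv_tent_ae_eq`). For the cone `k = k_R` of radius `R` the function `k_R * w` oscillates by
`O(R^{σ - 2})` on bounded sets, so `w` is constant because `σ < 2` (`exists_const_of_fixed`).

*The null space.* Weighted Young and Cauchy–Schwarz inequalities show that `R(z²)` is bounded on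
`L²_{-σ}`, so its extension is given by the same formula (`extendedResolvent_iff`), and `u` is a
null vector iff `u = -z² G * u + ∑ a_j G(· - y_j)` with `a = Γ(z)⁻¹ b`,
`b_k = -z² (G * u)(y_k)`. Then `w = u - ∑ a_j E(· - y_j)` satisfies `w = -z² G * w`, so it is a
constant `c`. Evaluating `-z² G * u` at the sites gives `b = c 1 - D̃ a + Γ(z) a`; as `Γ(z) a = b`,
this says `D̃ a = c 1`, which is `S D̃ a = 0` together with `c = ⟨D̃ a, 1⟩ / N`. The same computation
read backwards shows that every such potential is a null vector.
-/

noncomputable section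

namespace PointInteraction

section

/-! ### Laplace transforms on the right half plane -/

/-- `φ` is measurable and its Laplace transform over `(ρ, ∞)` converges absolutely for
`Re p > 0`. -/
def LaplaceIntegrable (ρ : ℝ) (φ : ℝ → ℂ) : Prop :=
  Measurable φ ∧ ∀ ε : ℝ, 0 < ε → IntegrableOn (fun r => ‖φ r‖ * Real.exp (-(ε * r))) (Set.Ioi ρ)

theorem norm_cexp_neg_mul (p : ℂ) (r : ℝ) : ‖Complex.exp (-(p * r))‖ = Real.exp (-(p.re * r)) := by
  rw [Complex.norm_exp]; simp

theorem LaplaceIntegrable.integrableOn {ρ : ℝ} {φ : ℝ → ℂ} (h : LaplaceIntegrable ρ φ) {p : ℂ}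
    (hp : 0 < p.re) : IntegrableOn (fun r : ℝ => φ r * Complex.exp (-(p * r))) (Set.Ioi ρ) := by
  refine (integrable_norm_iff ?_).1 ?_
  · have := h.1
    exact (by fun_prop : Measurable fun r : ℝ => φ r * Complex.exp (-(p * r))).aestronglyMeasurable
  · simpa only [norm_mul, norm_cexp_neg_mul] using! h.2 _ hp

theorem LaplaceIntegrable.id_mul {ρ : ℝ} (hρ : 0 ≤ ρ) {φ : ℝ → ℂ} (h : LaplaceIntegrable ρ φ) :
    LaplaceIntegrable ρ (fun r => (r : ℂ) * φ r) := by
  have hm := h.1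
  refine ⟨by fun_prop, fun ε hε => ?_⟩
  refine Integrable.mono' ((h.2 (ε / 2) (by positivity)).const_mul (2 / ε))
    (by fun_prop : Measurable _).aestronglyMeasurable ?_
  filter_upwards [ae_restrict_mem measurableSet_Ioi] with r hr
  have hr0 : 0 ≤ r := hρ.trans (le_of_lt hr)
  have h1 : ε / 2 * r ≤ Real.exp (ε / 2 * r) := by
    linarith [Real.add_one_le_exp (ε / 2 * r)]
  have h2 : r * Real.exp (-(ε * r)) ≤ 2 / ε * Real.exp (-(ε / 2 * r)) := by
    have h3 : Real.exp (-(ε * r)) = Real.exp (-(ε / 2 * r)) * Real.exp (-(ε / 2 * r)) := by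
      rw [← Real.exp_add]; ring_nf
    have h4 : Real.exp (ε / 2 * r) * Real.exp (-(ε / 2 * r)) = 1 := by
      rw [← Real.exp_add]; simp
    have h5 : ε / 2 * r * Real.exp (-(ε / 2 * r)) ≤ 1 := by
      rw [← h4]; gcongr
    have h6 : r * Real.exp (-(ε / 2 * r)) ≤ 2 / ε := by
      rw [le_div_iff₀ hε]; linarith
    rw [h3, ← mul_assoc]
    gcongr
  rw [Real.norm_of_nonneg (by positivity), norm_mul, Complex.norm_real, Real.norm_of_nonneg hr0]
  calc r * ‖φ r‖ * Real.exp (-(ε * r)) = ‖φ r‖ * (r * Real.exp (-(ε * r))) := by ring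
    _ ≤ ‖φ r‖ * (2 / ε * Real.exp (-(ε / 2 * r))) := by gcongr
    _ = _ := by ring

theorem LaplaceIntegrable.hasDerivAt {ρ : ℝ} (hρ : 0 ≤ ρ) {φ : ℝ → ℂ} (h : LaplaceIntegrable ρ φ)
    {p : ℂ} (hp : 0 < p.re) :
    HasDerivAt (fun p : ℂ => ∫ r in Set.Ioi ρ, φ r * Complex.exp (-(p * r)))
      (-∫ r in Set.Ioi ρ, (r : ℂ) * φ r * Complex.exp (-(p * r))) p := by
  have hm := h.1
  rw [← integral_neg]
  refine (hasDerivAt_integral_of_dominated_loc_of_deriv_le (μ := volume.restrict (Set.Ioi ρ))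
    (F := fun (p : ℂ) (r : ℝ) => φ r * Complex.exp (-(p * r)))
    (F' := fun (p : ℂ) (r : ℝ) => -((r : ℂ) * φ r * Complex.exp (-(p * r))))
    (bound := fun r => ‖(r : ℂ) * φ r‖ * Real.exp (-(p.re / 2 * r)))
    (Metric.ball_mem_nhds p (half_pos hp)) ?_ (h.integrableOn hp) ?_ ?_
    ((h.id_mul hρ).2 _ (half_pos hp)) ?_).2
  · filter_upwards with x
    exact (by fun_prop : Measurable fun r : ℝ => φ r * Complex.exp (-(x * r))).aestronglyMeasurable
  · exact (by fun_prop : Measurable fun r : ℝ =>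
      -((r : ℂ) * φ r * Complex.exp (-(p * r)))).aestronglyMeasurable
  · filter_upwards [ae_restrict_mem measurableSet_Ioi] with r hr x hx
    have hr0 : 0 ≤ r := hρ.trans (le_of_lt hr)
    rw [norm_neg, norm_mul, norm_cexp_neg_mul]
    have h1 : ‖x - p‖ < p.re / 2 := by simpa [dist_eq_norm] using hx
    have h2 := (Complex.abs_re_le_norm (x - p)).trans_lt h1
    rw [Complex.sub_re, abs_lt] at h2
    gcongr
    linarith
  · filter_upwards with r x _
    have h1 : HasDerivAt (fun x : ℂ => Complex.exp (-(x * r)))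
        (Complex.exp (-(x * r)) * (-(1 * r))) x :=
      (((hasDerivAt_id x).mul_const (r : ℂ)).neg).cexp
    convert! h1.const_mul (φ r) using 1
    ring

/-- The elementary bound `|log r| ≤ 2 r^{-1/2} + r`. -/
theorem abs_log_le {r : ℝ} (hr : 0 < r) : |Real.log r| ≤ 2 * r ^ (-(1 / 2) : ℝ) + r := by
  have h0 : 0 ≤ r ^ (-(1 / 2) : ℝ) := by positivity
  rw [abs_le]
  constructor
  · have h1 := Real.log_le_rpow_div (inv_pos.2 hr).le (by norm_num : (0 : ℝ) < 1 / 2)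
    rw [Real.log_inv, Real.inv_rpow hr.le, ← Real.rpow_neg hr.le] at h1
    linarith
  · linarith [Real.log_le_sub_one_of_pos hr]

theorem integrableOn_rpow_mul_exp {s ε : ℝ} (hs : -1 < s) (hε : 0 < ε) :
    IntegrableOn (fun r : ℝ => r ^ s * Real.exp (-(ε * r))) (Set.Ioi 0) := by
  simpa using integrableOn_rpow_mul_exp_neg_mul_rpow hs one_pos hε

theorem laplaceIntegrable_log : LaplaceIntegrable 0 (fun r => (Real.log r : ℂ)) := by
  refine ⟨by fun_prop, fun ε hε => ?_⟩
  have h1 := (integrableOn_rpow_mul_exp (s := -(1 / 2)) (by norm_num) hε).const_mul 2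
  have h2 := integrableOn_rpow_mul_exp (s := 1) (by norm_num) hε
  refine Integrable.mono' (h1.add h2) (by fun_prop : Measurable _).aestronglyMeasurable ?_
  filter_upwards [ae_restrict_mem measurableSet_Ioi] with r hr
  have := abs_log_le hr
  rw [Real.norm_of_nonneg (by positivity), Complex.norm_real, Real.norm_eq_abs, Pi.add_apply,
    Real.rpow_one]
  nlinarith [Real.exp_pos (-(ε * r))]

theorem laplaceIntegrable_log_div {ρ : ℝ} (hρ : 0 < ρ) :
    LaplaceIntegrable ρ (fun r => (Real.log (r / ρ) : ℂ)) := by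
  refine ⟨by fun_prop, fun ε hε => ?_⟩
  have h1 := (laplaceIntegrable_log.2 ε hε).mono_set (Set.Ioi_subset_Ioi hρ.le)
  have h2 := ((integrableOn_rpow_mul_exp (s := 0) (by norm_num) hε).mono_set
    (Set.Ioi_subset_Ioi hρ.le)).const_mul |Real.log ρ|
  refine Integrable.mono' (h1.add h2) (by fun_prop : Measurable _).aestronglyMeasurable ?_
  filter_upwards [ae_restrict_mem measurableSet_Ioi] with r hr
  have hr0 : 0 < r := hρ.trans hr
  rw [Real.norm_of_nonneg (by positivity), Complex.norm_real, Real.norm_eq_abs, Pi.add_apply,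
    Real.rpow_zero, Real.log_div hr0.ne' hρ.ne', Complex.norm_real, Real.norm_eq_abs]
  nlinarith [Real.exp_pos (-(ε * r)), abs_sub (Real.log r) (Real.log ρ)]

theorem integral_exp_Ioi {p : ℂ} (hp : 0 < p.re) (ρ : ℝ) :
    ∫ r : ℝ in Set.Ioi ρ, Complex.exp (-(p * r)) = Complex.exp (-(p * ρ)) / p := by
  have h := integral_exp_mul_complex_Ioi (a := -p) (by simpa using hp) ρ
  simpa [neg_div_neg_eq] using h

theorem ne_zero_of_re_pos {p : ℂ} (hp : 0 < p.re) : p ≠ 0 := by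
  rintro rfl; simp at hp

theorem tendsto_id_mul_log_mul_exp {p : ℂ} (hp : 0 < p.re) {c : ℝ} (hc : 0 < c) :
    Tendsto (fun r : ℝ => -(p * r * (Real.log (r / c) : ℂ)) * Complex.exp (-(p * r)))
      atTop (𝓝 0) := by
  have h1 : Tendsto (fun r : ℝ => ‖p‖ / c * (r ^ (2 : ℝ) * Real.exp (-p.re * r))) atTop (𝓝 0) := by
    simpa using (tendsto_rpow_mul_exp_neg_mul_atTop_nhds_zero 2 p.re hp).const_mul (‖p‖ / c)
  refine squeeze_zero_norm' ?_ h1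
  filter_upwards [eventually_ge_atTop c] with r hr
  have hr0 : 0 < r := hc.trans_le hr
  have h2 : 0 ≤ Real.log (r / c) := Real.log_nonneg ((one_le_div hc).2 hr)
  have h3 : Real.log (r / c) ≤ r / c := by
    linarith [Real.log_le_sub_one_of_pos (div_pos hr0 hc)]
  rw [norm_mul, norm_neg, norm_mul, norm_mul, norm_cexp_neg_mul, Complex.norm_real,
    Complex.norm_real, Real.norm_of_nonneg hr0.le, Real.norm_of_nonneg h2, Real.rpow_two]
  calc ‖p‖ * r * Real.log (r / c) * Real.exp (-(p.re * r))
      ≤ ‖p‖ * r * (r / c) * Real.exp (-(p.re * r)) := by gcongr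
    _ = _ := by rw [neg_mul]; ring

/-- Integration by parts: with `W = ∫ log (r / c) e^{-pr} dr` and `L = ∫ r log (r / c) e^{-pr} dr`
over `(ρ, ∞)`, one has `p² L = p W + e^{-pρ}` as soon as `r log (r / c)` vanishes at `r = ρ`. -/
theorem laplace_id_mul_log {ρ c : ℝ} (hρ : 0 ≤ ρ) (hc : 0 < c) (h0 : ρ * Real.log (ρ / c) = 0)
    (h : LaplaceIntegrable ρ (fun r => (Real.log (r / c) : ℂ))) {p : ℂ} (hp : 0 < p.re) :
    p ^ 2 * (∫ r in Set.Ioi ρ, (r : ℂ) * (Real.log (r / c) : ℂ) * Complex.exp (-(p * r))) =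
      p * (∫ r in Set.Ioi ρ, (Real.log (r / c) : ℂ) * Complex.exp (-(p * r)))
        + Complex.exp (-(p * ρ)) := by
  have i1 := h.integrableOn hp
  have i2 := (h.id_mul hρ).integrableOn hp
  have i3 : IntegrableOn (fun r : ℝ => Complex.exp (-(p * r))) (Set.Ioi ρ) := by
    simpa using integrableOn_exp_mul_complex_Ioi (a := -p) (by simpa using hp) ρ
  have hcont : Continuous fun r : ℝ =>
      -(p * r * (Real.log (r / c) : ℂ)) * Complex.exp (-(p * r)) := by
    have h1 : Continuous fun r : ℝ => ((c * ((r / c) * Real.log (r / c)) : ℝ) : ℂ) := by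
      have := Real.continuous_mul_log
      exact Complex.continuous_ofReal.comp
        (continuous_const.mul (this.comp (continuous_id.div_const c)))
    have h2 : (fun r : ℝ => -(p * r * (Real.log (r / c) : ℂ)) * Complex.exp (-(p * r))) =
        fun r : ℝ => -(p * ((c * ((r / c) * Real.log (r / c)) : ℝ) : ℂ)) *
          Complex.exp (-(p * r)) := by
      ext r
      have : (c : ℂ) ≠ 0 := by exact_mod_cast hc.ne'
      push_cast
      field_simp
    rw [h2]
    fun_prop
  have j1 : IntegrableOn (fun r : ℝ => p * ((Real.log (r / c) : ℂ) * Complex.exp (-(p * r))))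
    (Set.Ioi ρ) := i1.const_mul p
  have j2 : IntegrableOn (fun r : ℝ => p ^ 2 * ((r : ℂ) * (Real.log (r / c) : ℂ) *
    Complex.exp (-(p * r)))) (Set.Ioi ρ) := i2.const_mul (p ^ 2)
  have j3 : IntegrableOn (fun r : ℝ => p * Complex.exp (-(p * r))) (Set.Ioi ρ) := i3.const_mul p
  have j4 : IntegrableOn (fun r : ℝ => p ^ 2 * ((r : ℂ) * (Real.log (r / c) : ℂ) *
    Complex.exp (-(p * r))) - p * ((Real.log (r / c) : ℂ) * Complex.exp (-(p * r)))) (Set.Ioi ρ) :=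
    j2.sub j1
  have key := integral_Ioi_of_hasDerivAt_of_tendsto (a := ρ) (m := 0)
    (f := fun r : ℝ => -(p * r * (Real.log (r / c) : ℂ)) * Complex.exp (-(p * r)))
    (f' := fun r : ℝ => p ^ 2 * ((r : ℂ) * (Real.log (r / c) : ℂ) * Complex.exp (-(p * r)))
      - p * ((Real.log (r / c) : ℂ) * Complex.exp (-(p * r))) - p * Complex.exp (-(p * r)))
    hcont.continuousWithinAt ?_ (j4.sub j3)
    (tendsto_id_mul_log_mul_exp hp hc)
  · rw [integral_sub j4 j3, integral_sub j2 j1, integral_const_mul, integral_const_mul,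
      integral_const_mul, integral_exp_Ioi hp] at key
    have h3 : p * (ρ : ℂ) * (Real.log (ρ / c) : ℂ) = 0 := by
      rw [mul_assoc, ← Complex.ofReal_mul, h0]; simp
    rw [h3, mul_div_cancel₀ _ (ne_zero_of_re_pos hp)] at key
    linear_combination key
  · intro r hr
    have hr0 : 0 < r := lt_of_le_of_lt hρ hr
    have d1 : HasDerivAt (fun r : ℝ => (Real.log (r / c) : ℂ)) ((r⁻¹ : ℝ) : ℂ) r := by
      have : HasDerivAt (fun r : ℝ => Real.log (r / c)) r⁻¹ r := by
        have := ((hasDerivAt_id r).div_const c).log (div_pos hr0 hc).ne'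
        convert! this using 1
        simp only [id]; field_simp
      exact this.ofReal_comp
    have d2 : HasDerivAt (fun r : ℝ => (r : ℂ)) 1 r := Complex.ofRealCLM.hasDerivAt
    have d3 : HasDerivAt (fun r : ℝ => Complex.exp (-(p * r)))
        (Complex.exp (-(p * r)) * -(p * 1)) r :=
      ((d2.const_mul p).neg).cexp
    have d4 := (((d2.const_mul p).mul d1).neg).mul d3
    convert! d4 using 1
    have : (r : ℂ) ≠ 0 := by exact_mod_cast hr0.ne'
    simp only [Pi.neg_apply, Pi.mul_apply]
    push_cast
    field_simp
    ring

theorem integral_log_mul_exp_one :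
    ∫ r in Set.Ioi (0 : ℝ), (Real.log r : ℂ) * Complex.exp (-(1 * (r : ℂ))) =
      -(Real.eulerMascheroniConstant : ℂ) := by
  have h1 := Complex.hasDerivAt_GammaIntegral (s := 1) (by simp)
  have h2 : Complex.GammaIntegral =ᶠ[𝓝 1] Complex.Gamma := by
    have : ∀ᶠ s : ℂ in 𝓝 1, 0 < s.re :=
      (isOpen_lt continuous_const Complex.continuous_re).mem_nhds (by simp)
    filter_upwards [this] with s hs
    exact (Complex.Gamma_eq_integral hs).symm
  have h3 := (h1.congr_of_eventuallyEq h2.symm).unique Complex.hasDerivAt_Gamma_one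
  rw [← h3]
  refine setIntegral_congr_fun measurableSet_Ioi fun r hr => ?_
  simp

/-- `p ∫₀^∞ log r e^{-pr} dr = -γ - log p` for `Re p > 0`: the derivative of
`p ∫ log r e^{-pr} dr + log p` vanishes by `laplace_id_mul_log`, and its value at `p = 1` is
`Γ'(1)`. -/
theorem integral_log_mul_exp {p : ℂ} (hp : 0 < p.re) :
    p * ∫ r in Set.Ioi (0 : ℝ), (Real.log r : ℂ) * Complex.exp (-(p * r)) =
      -(Real.eulerMascheroniConstant : ℂ) - Complex.log p := by
  set U : Set ℂ := {p | 0 < p.re}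
  have hU : IsOpen U := isOpen_lt continuous_const Complex.continuous_re
  have hUc : IsPreconnected U := (convex_halfSpace_re_gt 0).isPreconnected
  have hderiv : ∀ p ∈ U, HasDerivAt (fun p : ℂ =>
      p * (∫ r in Set.Ioi (0 : ℝ), (Real.log r : ℂ) * Complex.exp (-(p * r))) + Complex.log p)
      0 p := by
    intro p hp
    have hp0 := ne_zero_of_re_pos hp
    have d1 := laplaceIntegrable_log.hasDerivAt le_rfl hp
    have d2 := ((hasDerivAt_id p).mul d1).add (Complex.hasDerivAt_log (Or.inl hp))
    convert! d2 using 1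
    have h3 := laplace_id_mul_log le_rfl one_pos (by simp)
      (by simpa using laplaceIntegrable_log) hp
    simp only [div_one, Complex.ofReal_zero, mul_zero, neg_zero, Complex.exp_zero] at h3
    simp only [id]
    field_simp
    linear_combination h3
  have hconst := hU.is_const_of_deriv_eq_zero hUc
    (fun p hp => (hderiv p hp).differentiableAt.differentiableWithinAt)
    (fun p hp => (hderiv p hp).deriv) hp (show (1 : ℂ) ∈ U by simp [U])
  simp only [integral_log_mul_exp_one, Complex.log_one] at hconst
  linear_combination hconst

end

section

/-! ### The Hankel kernel as a Laplace transform -/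

/-- The square root of `(τ + q)² - q² = 2τ (τ/2 + q)`, as a product of principal branches. -/
def root (q : ℂ) (τ : ℝ) : ℂ := (Real.sqrt (2 * τ) : ℂ) * ((τ : ℂ) / 2 + q) ^ (1 / 2 : ℂ)

variable {q : ℂ}

theorem add_re_pos (hq : 0 < q.re) {τ : ℝ} (hτ : 0 ≤ τ) : 0 < ((τ : ℂ) + q).re := by
  simp only [Complex.add_re, Complex.ofReal_re]; positivity

theorem half_add_re_pos (hq : 0 < q.re) {τ : ℝ} (hτ : 0 ≤ τ) : 0 < ((τ : ℂ) / 2 + q).re := by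
  have := add_re_pos hq (τ := τ / 2) (by positivity)
  simpa using this

theorem root_sq (q : ℂ) {τ : ℝ} (hτ : 0 ≤ τ) : root q τ ^ 2 = ((τ : ℂ) + q) ^ 2 - q ^ 2 := by
  have h1 : ((Real.sqrt (2 * τ) : ℂ)) ^ 2 = 2 * τ := by
    rw [← Complex.ofReal_pow, Real.sq_sqrt (by positivity)]; push_cast; ring
  have h2 : (((τ : ℂ) / 2 + q) ^ (1 / 2 : ℂ)) ^ 2 = (τ : ℂ) / 2 + q := by
    rw [← Complex.cpow_mul_nat]; simp
  rw [root, mul_pow, h1, h2]; ring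

theorem root_zero (q : ℂ) : root q 0 = 0 := by simp [root]

theorem norm_root_sq (q : ℂ) {τ : ℝ} (hτ : 0 ≤ τ) : ‖root q τ‖ ^ 2 = 2 * τ * ‖(τ : ℂ) / 2 + q‖ := by
  have : root q τ ^ 2 = 2 * τ * ((τ : ℂ) / 2 + q) := by rw [root_sq q hτ]; ring
  rw [← norm_pow, this]
  simp [abs_of_nonneg hτ]

theorem sqrt_le_norm_root (q : ℂ) {τ : ℝ} (hτ : 0 ≤ τ) :
    Real.sqrt (2 * q.re * τ) ≤ ‖root q τ‖ := by
  refine Real.sqrt_le_iff.2 ⟨norm_nonneg _, ?_⟩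
  have h := Complex.re_le_norm ((τ : ℂ) / 2 + q)
  have h1 : ((τ : ℂ) / 2 + q).re = τ / 2 + q.re := by simp
  rw [norm_root_sq q hτ]
  nlinarith

theorem root_ne_zero (hq : 0 < q.re) {τ : ℝ} (hτ : 0 < τ) : root q τ ≠ 0 := by
  intro h
  have h1 := norm_root_sq q hτ.le
  rw [h] at h1
  have h2 := norm_pos_iff.2 (ne_zero_of_re_pos (half_add_re_pos hq hτ.le))
  simp at h1
  rcases h1 with h1 | h1
  · exact hτ.ne' h1
  · exact ne_zero_of_re_pos (half_add_re_pos hq hτ.le) h1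

theorem root_re_nonneg (q : ℂ) (τ : ℝ) : 0 ≤ (root q τ).re := by
  have h1 : (1 / 2 : ℂ) = ((1 / 2 : ℝ) : ℂ) := by norm_num
  rw [root, Complex.re_ofReal_mul, h1, Complex.cpow_ofReal_re]
  have := Complex.neg_pi_lt_arg ((τ : ℂ) / 2 + q)
  have := Complex.arg_le_pi ((τ : ℂ) / 2 + q)
  have : 0 ≤ Real.cos (Complex.arg ((τ : ℂ) / 2 + q) * (1 / 2)) :=
    Real.cos_nonneg_of_mem_Icc ⟨by linarith, by linarith⟩
  positivity

theorem continuousOn_root (hq : 0 < q.re) : ContinuousOn (root q) (Set.Ici 0) := by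
  intro τ hτ
  have h1 : ContinuousAt (fun τ : ℝ => ((τ : ℂ) / 2 + q) ^ (1 / 2 : ℂ)) τ :=
    (by fun_prop : Continuous fun τ : ℝ => (τ : ℂ) / 2 + q).continuousAt.cpow continuousAt_const
      (Or.inl (half_add_re_pos hq hτ))
  have h2 : ContinuousAt (fun τ : ℝ => (Real.sqrt (2 * τ) : ℂ)) τ := by fun_prop
  exact (h2.mul h1).continuousWithinAt

theorem hasDerivAt_root (hq : 0 < q.re) {τ : ℝ} (hτ : 0 < τ) :
    HasDerivAt (root q) (((τ : ℂ) + q) / root q τ) τ := by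
  have d0 : HasDerivAt (fun r : ℝ => (r : ℂ)) 1 τ := Complex.ofRealCLM.hasDerivAt
  have d1 : DifferentiableAt ℝ (fun τ : ℝ => (Real.sqrt (2 * τ) : ℂ)) τ :=
    (((hasDerivAt_id τ).const_mul 2).sqrt (by simp [hτ.ne'])).ofReal_comp.differentiableAt
  have d2 : DifferentiableAt ℝ (fun τ : ℝ => ((τ : ℂ) / 2 + q) ^ (1 / 2 : ℂ)) τ := by
    have h : HasDerivAt (fun x : ℂ => (x / 2 + q) ^ (1 / 2 : ℂ)) _ (τ : ℂ) :=
      (((hasDerivAt_id (τ : ℂ)).div_const 2).add_const q).cpow_const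
        (Or.inl (half_add_re_pos hq hτ.le))
    exact h.comp_ofReal.differentiableAt
  have d3 : DifferentiableAt ℝ (root q) τ := d1.mul d2
  have h1 := d3.hasDerivAt.pow 2
  have h2 : HasDerivAt (fun τ : ℝ => ((τ : ℂ) + q) ^ 2 - q ^ 2) (2 * ((τ : ℂ) + q)) τ := by
    convert! ((d0.add_const q).pow 2).sub_const (q ^ 2) using 1
    simp
  have h3 : (root q ^ 2) =ᶠ[𝓝 τ] fun τ : ℝ => ((τ : ℂ) + q) ^ 2 - q ^ 2 := by
    filter_upwards [lt_mem_nhds hτ] with t ht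
    exact root_sq q ht.le
  -- Differentiating `root² = (τ + q)² - q²` avoids differentiating the product of powers.
  have h4 := (h1.congr_of_eventuallyEq h3.symm).unique h2
  have hr := root_ne_zero hq hτ
  convert! d3.hasDerivAt using 1
  rw [div_eq_iff hr]
  norm_num at h4
  linear_combination -(1 / 2 : ℂ) * h4

theorem norm_root_add_ge (hq : 0 < q.re) (τ : ℝ) : τ ≤ ‖root q τ + ((τ : ℂ) + q)‖ := by
  refine le_trans ?_ (Complex.re_le_norm _)
  have := root_re_nonneg q τ
  simp only [Complex.add_re, Complex.ofReal_re]
  linarith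

theorem measurable_root : Measurable (root q) := by
  unfold root
  fun_prop

/-- The Hankel kernel on the ray through `z = i q` as a Laplace transform in `r`. -/
theorem hankelKernel_eq_laplace (hq : 0 < q.re) {r : ℝ} (hr : 0 < r) :
    hankelKernel (Complex.I * q * r) =
      1 / (2 * Real.pi) *
        ∫ τ in Set.Ioi (0 : ℝ), Complex.exp (-(((τ : ℂ) + q) * r)) / root q τ := by
  have e1 : Complex.I * (Complex.I * q * r) = -(q * r) := by
    rw [← mul_assoc, ← mul_assoc, Complex.I_mul_I]; ring
  have h1 := integral_comp_mul_left_Ioi' (fun t : ℝ =>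
    ((Real.exp (-t) * t ^ (-(1 / 2) : ℝ) : ℝ) : ℂ) *
        ((t : ℂ) / 2 - Complex.I * (Complex.I * q * r)) ^ (-(1 / 2) : ℂ)) 0 hr
  rw [mul_zero] at h1
  rw [hankelKernel, ← h1, e1, ← integral_smul, ← integral_const_mul, ← integral_const_mul]
  refine setIntegral_congr_fun measurableSet_Ioi fun τ hτ => ?_
  have hτ : 0 < τ := hτ
  have hne := ne_zero_of_re_pos (half_add_re_pos hq hτ.le)
  have e2 : ((r * τ : ℝ) : ℂ) / 2 - -(q * r) = (r : ℂ) * ((τ : ℂ) / 2 + q) := by push_cast; ring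
  have e3 : ((r : ℂ) * ((τ : ℂ) / 2 + q)) ^ (-(1 / 2) : ℂ) =
      ((r ^ (-(1 / 2) : ℝ) : ℝ) : ℂ) * ((τ : ℂ) / 2 + q) ^ (-(1 / 2) : ℂ) := by
    have hrc : (r : ℂ) ≠ 0 := by exact_mod_cast hr.ne'
    rw [Complex.cpow_def_of_ne_zero (mul_ne_zero hrc hne), Complex.cpow_def_of_ne_zero hne,
      Complex.log_ofReal_mul hr hne, Real.rpow_def_of_pos hr, add_mul, Complex.exp_add]
    push_cast; rfl
  have e4 : (r * τ) ^ (-(1 / 2) : ℝ) = r ^ (-(1 / 2) : ℝ) * τ ^ (-(1 / 2) : ℝ) :=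
    Real.mul_rpow hr.le hτ.le
  have e5 : r * (r ^ (-(1 / 2) : ℝ) * r ^ (-(1 / 2) : ℝ)) = 1 := by
    rw [← Real.rpow_add hr]; norm_num
    rw [Real.rpow_neg_one]; field_simp
  have e6 : ((τ : ℂ) / 2 + q) ^ (-(1 / 2) : ℂ) = (((τ : ℂ) / 2 + q) ^ (1 / 2 : ℂ))⁻¹ :=
    Complex.cpow_neg _ _
  have e7 : τ ^ (-(1 / 2) : ℝ) = (Real.sqrt τ)⁻¹ := by
    rw [Real.rpow_neg hτ.le, Real.sqrt_eq_rpow]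
  have e8 : (2 : ℝ) ^ (3 / 2 : ℝ) = 2 * Real.sqrt 2 := by
    rw [Real.sqrt_eq_rpow, show (3 / 2 : ℝ) = 1 + 1 / 2 by norm_num, Real.rpow_add two_pos,
      Real.rpow_one]
  have e9 : Complex.exp (-(((τ : ℂ) + q) * r)) =
      Complex.exp (-(q * r)) * ((Real.exp (-(r * τ)) : ℝ) : ℂ) := by
    rw [Complex.ofReal_exp, ← Complex.exp_add]; congr 1; push_cast; ring
  have e10 : ((r : ℂ)) * (((r ^ (-(1 / 2) : ℝ) : ℝ) : ℂ) * ((r ^ (-(1 / 2) : ℝ) : ℝ) : ℂ)) = 1 := by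
    exact_mod_cast e5
  simp only [Complex.real_smul]
  rw [e2, e3, e4, e6, e7, e8, e9, root, Real.sqrt_mul zero_le_two]
  generalize r ^ (-(1 / 2) : ℝ) = B at e10 ⊢
  push_cast
  simp only [div_eq_mul_inv, mul_inv]
  generalize (((τ : ℂ) * 2⁻¹ + q) ^ (1 * 2⁻¹ : ℂ))⁻¹ = X
  generalize ((Real.sqrt τ : ℝ) : ℂ)⁻¹ = A
  generalize ((Real.sqrt 2 : ℝ) : ℂ)⁻¹ = A2
  linear_combination (Complex.exp (-(q * r)) * Complex.exp (-(r * τ)) * A * A2 * X *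
    (2⁻¹ * (Real.pi : ℂ)⁻¹)) * e10

theorem norm_inv_root_le (hq : 0 < q.re) {τ : ℝ} (hτ : 0 < τ) :
    ‖(root q τ)⁻¹‖ ≤ (Real.sqrt (2 * q.re))⁻¹ * τ ^ (-(1 / 2) : ℝ) := by
  have h := sqrt_le_norm_root q hτ.le
  have h1 : 0 < Real.sqrt (2 * q.re * τ) := Real.sqrt_pos.2 (by positivity)
  rw [norm_inv, Real.rpow_neg hτ.le, ← Real.sqrt_eq_rpow, ← mul_inv,
    ← Real.sqrt_mul (by positivity)]
  exact inv_anti₀ h1 h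

theorem norm_laplace_integrand_le (hq : 0 < q.re) {r τ : ℝ} (hτ : 0 < τ) :
    ‖Complex.exp (-(((τ : ℂ) + q) * r)) / root q τ‖ ≤
      Real.exp (-(q.re * r)) * ((Real.sqrt (2 * q.re))⁻¹ *
        (τ ^ (-(1 / 2) : ℝ) * Real.exp (-(r * τ)))) := by
  rw [div_eq_mul_inv, norm_mul, norm_cexp_neg_mul]
  have h1 := norm_inv_root_le hq hτ
  have h2 : Real.exp (-(((τ : ℂ) + q).re * r)) = Real.exp (-(q.re * r)) * Real.exp (-(r * τ)) := by
    rw [← Real.exp_add]; congr 1; simp only [Complex.add_re, Complex.ofReal_re]; ring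
  rw [h2]
  calc _ ≤ Real.exp (-(q.re * r)) * Real.exp (-(r * τ)) *
        ((Real.sqrt (2 * q.re))⁻¹ * τ ^ (-(1 / 2) : ℝ)) := by gcongr
    _ = _ := by ring

theorem integral_rpow_neg_half_mul_exp {r : ℝ} (hr : 0 < r) :
    ∫ τ in Set.Ioi (0 : ℝ), τ ^ (-(1 / 2) : ℝ) * Real.exp (-(r * τ)) =
      Real.Gamma (1 / 2) * r ^ (-(1 / 2) : ℝ) := by
  have h := Real.integral_rpow_mul_exp_neg_mul_Ioi (a := 1 / 2) (by norm_num) hr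
  rw [show (1 / 2 : ℝ) - 1 = -(1 / 2) by norm_num] at h
  rw [h, one_div r, Real.inv_rpow hr.le, ← Real.rpow_neg hr.le, mul_comm]

theorem integrable_prod_laplace (hq : 0 < q.re) {ρ : ℝ} (hρ : 0 ≤ ρ) {φ : ℝ → ℂ}
    (hφm : Measurable φ)
    (hφ : IntegrableOn (fun r => ‖φ r‖ * (r ^ (-(1 / 2) : ℝ) * Real.exp (-(q.re * r))))
      (Set.Ioi ρ)) :
    Integrable (Function.uncurry fun r τ : ℝ =>
        φ r * (Complex.exp (-(((τ : ℂ) + q) * r)) / root q τ))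
      ((volume.restrict (Set.Ioi ρ)).prod (volume.restrict (Set.Ioi 0))) := by
  have hmr := measurable_root (q := q)
  have hD : Integrable (fun x : ℝ × ℝ => ‖φ x.1‖ * (Real.exp (-(q.re * x.1)) *
      ((Real.sqrt (2 * q.re))⁻¹ * (x.2 ^ (-(1 / 2) : ℝ) * Real.exp (-(x.1 * x.2))))))
      ((volume.restrict (Set.Ioi ρ)).prod (volume.restrict (Set.Ioi 0))) := by
    refine (integrable_prod_iff (by fun_prop : Measurable _).aestronglyMeasurable).2 ⟨?_, ?_⟩
    · filter_upwards [ae_restrict_mem measurableSet_Ioi] with r hr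
      exact (((integrableOn_rpow_mul_exp (by norm_num) (hρ.trans_lt hr)).const_mul _).const_mul
        _).const_mul _
    · refine (hφ.const_mul ((Real.sqrt (2 * q.re))⁻¹ * Real.Gamma (1 / 2))).congr ?_
      filter_upwards [ae_restrict_mem measurableSet_Ioi] with r hr
      have hr0 : 0 < r := hρ.trans_lt hr
      have : ∀ τ ∈ Set.Ioi (0 : ℝ), ‖‖φ r‖ * (Real.exp (-(q.re * r)) *
          ((Real.sqrt (2 * q.re))⁻¹ * (τ ^ (-(1 / 2) : ℝ) * Real.exp (-(r * τ)))))‖ =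
          ‖φ r‖ * (Real.exp (-(q.re * r)) *
          ((Real.sqrt (2 * q.re))⁻¹ * (τ ^ (-(1 / 2) : ℝ) * Real.exp (-(r * τ))))) := by
        intro τ hτ
        have hτ : 0 < τ := hτ
        exact Real.norm_of_nonneg (by positivity)
      rw [setIntegral_congr_fun measurableSet_Ioi this, integral_const_mul, integral_const_mul,
        integral_const_mul, integral_rpow_neg_half_mul_exp hr0]
      ring
  refine hD.mono' ?_ ?_
  · have : Measurable (Function.uncurry fun r τ : ℝ =>
        φ r * (Complex.exp (-(((τ : ℂ) + q) * r)) / root q τ)) := by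
      unfold Function.uncurry
      fun_prop
    exact this.aestronglyMeasurable
  · rw [Measure.prod_restrict]
    filter_upwards [ae_restrict_mem (measurableSet_Ioi.prod measurableSet_Ioi)] with x hx
    simp only [Function.uncurry, norm_mul]
    have := norm_laplace_integrand_le hq (r := x.1) hx.2
    gcongr

/-- Integrals against the Hankel kernel reduce to Laplace transforms. -/
theorem integral_mul_hankelKernel (hq : 0 < q.re) {ρ : ℝ} (hρ : 0 ≤ ρ) {φ : ℝ → ℂ}
    (hφm : Measurable φ)
    (hφ : IntegrableOn (fun r => ‖φ r‖ * (r ^ (-(1 / 2) : ℝ) * Real.exp (-(q.re * r))))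
      (Set.Ioi ρ)) :
    IntegrableOn (fun r : ℝ => φ r * hankelKernel (Complex.I * q * r)) (Set.Ioi ρ) ∧
    IntegrableOn (fun τ : ℝ => (∫ r in Set.Ioi ρ, φ r * Complex.exp (-(((τ : ℂ) + q) * r))) /
      root q τ) (Set.Ioi 0) ∧
    ∫ r in Set.Ioi ρ, φ r * hankelKernel (Complex.I * q * r) = 1 / (2 * Real.pi) *
      ∫ τ in Set.Ioi (0 : ℝ), (∫ r in Set.Ioi ρ, φ r * Complex.exp (-(((τ : ℂ) + q) * r))) /
        root q τ := by
  have h := integrable_prod_laplace hq hρ hφm hφ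
  have e1 : ∀ τ : ℝ, (∫ r in Set.Ioi ρ, φ r * Complex.exp (-(((τ : ℂ) + q) * r))) / root q τ =
      ∫ r in Set.Ioi ρ, φ r * (Complex.exp (-(((τ : ℂ) + q) * r)) / root q τ) := by
    intro τ
    rw [← integral_div]
    simp only [mul_div_assoc]
  have e2 : ∀ r ∈ Set.Ioi ρ, φ r * hankelKernel (Complex.I * q * r) = 1 / (2 * Real.pi) *
      ∫ τ in Set.Ioi (0 : ℝ), φ r * (Complex.exp (-(((τ : ℂ) + q) * r)) / root q τ) := by
    intro r hr
    rw [hankelKernel_eq_laplace hq (hρ.trans_lt hr), integral_const_mul]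
    ring
  simp only [e1]
  refine ⟨?_, h.integral_prod_right, ?_⟩
  · exact (integrableOn_congr_fun e2 measurableSet_Ioi).2 (h.integral_prod_left.const_mul _)
  · rw [setIntegral_congr_fun measurableSet_Ioi e2, integral_const_mul, integral_integral_swap h]

/-- The only size estimate on the kernel that is needed; the singularity `r^{-1/2}` overestimates
the true logarithm, but is square integrable in the plane. -/
theorem norm_hankelKernel_le (hq : 0 < q.re) : ∃ C : ℝ, ∀ r : ℝ, 0 < r →
    ‖hankelKernel (Complex.I * q * r)‖ ≤ C * (Real.exp (-(q.re * r)) * r ^ (-(1 / 2) : ℝ)) := by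
  refine ⟨‖(1 / (2 * Real.pi) : ℂ)‖ * ((Real.sqrt (2 * q.re))⁻¹ * Real.Gamma (1 / 2)),
    fun r hr => ?_⟩
  rw [hankelKernel_eq_laplace hq hr, norm_mul]
  have h1 : ‖∫ τ in Set.Ioi (0 : ℝ), Complex.exp (-(((τ : ℂ) + q) * r)) / root q τ‖ ≤
      ∫ τ in Set.Ioi (0 : ℝ), Real.exp (-(q.re * r)) * ((Real.sqrt (2 * q.re))⁻¹ *
        (τ ^ (-(1 / 2) : ℝ) * Real.exp (-(r * τ)))) := by
    refine norm_integral_le_of_norm_le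
      (((integrableOn_rpow_mul_exp (by norm_num) hr).const_mul _).const_mul _) ?_
    filter_upwards [ae_restrict_mem measurableSet_Ioi] with τ hτ
    exact norm_laplace_integrand_le hq hτ
  rw [integral_const_mul, integral_const_mul, integral_rpow_neg_half_mul_exp hr] at h1
  calc _ ≤ ‖(1 / (2 * Real.pi) : ℂ)‖ * (Real.exp (-(q.re * r)) * ((Real.sqrt (2 * q.re))⁻¹ *
        (Real.Gamma (1 / 2) * r ^ (-(1 / 2) : ℝ)))) := by gcongr
    _ = _ := by ring

/-! ### Radial moments of the Hankel kernel -/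

theorem hasDerivAt_root_div (hq : 0 < q.re) {τ : ℝ} (hτ : 0 < τ) :
    HasDerivAt (fun τ : ℝ => root q τ / ((τ : ℂ) + q))
      (q ^ 2 / (((τ : ℂ) + q) ^ 2 * root q τ)) τ := by
  have d0 : HasDerivAt (fun r : ℝ => (r : ℂ)) 1 τ := Complex.ofRealCLM.hasDerivAt
  have hp := ne_zero_of_re_pos (add_re_pos hq hτ.le)
  have hr := root_ne_zero hq hτ
  convert! (hasDerivAt_root hq hτ).div (d0.add_const q) hp using 1
  field_simp
  rw [root_sq q hτ.le]; ring

/-- From `root - p = -q² / (root + p)`, where `Re (root + p) ≥ τ`. -/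
theorem tendsto_norm_mul_root_div_sub_one (hq : 0 < q.re) :
    Tendsto (fun τ : ℝ => ‖(τ : ℂ) + q‖ * ‖root q τ / ((τ : ℂ) + q) - 1‖) atTop (𝓝 0) := by
  have h1 : Tendsto (fun τ : ℝ => ‖q‖ ^ 2 / τ) atTop (𝓝 0) :=
    tendsto_const_nhds.div_atTop tendsto_id
  refine squeeze_zero' (Eventually.of_forall fun _ => by positivity) ?_ h1
  filter_upwards [eventually_gt_atTop 0] with τ hτ
  have hp := ne_zero_of_re_pos (add_re_pos hq hτ.le)
  have h2 : 0 < ‖root q τ + ((τ : ℂ) + q)‖ := hτ.trans_le (norm_root_add_ge hq τ)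
  rw [← norm_mul, mul_sub, mul_div_cancel₀ _ hp, mul_one, le_div_iff₀ hτ]
  calc ‖root q τ - ((τ : ℂ) + q)‖ * τ
      ≤ ‖root q τ - ((τ : ℂ) + q)‖ * ‖root q τ + ((τ : ℂ) + q)‖ := by
        gcongr; exact norm_root_add_ge hq τ
    _ = ‖q‖ ^ 2 := by
      rw [← norm_mul, ← norm_pow, ← norm_neg (q ^ 2)]
      congr 1
      linear_combination root_sq q hτ.le

theorem tendsto_norm_add_atTop (q : ℂ) : Tendsto (fun τ : ℝ => ‖(τ : ℂ) + q‖) atTop atTop := by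
  refine tendsto_atTop_mono (f := fun τ => τ + q.re) (fun τ => ?_)
    (tendsto_atTop_add_const_right _ _ tendsto_id)
  simpa using Complex.re_le_norm ((τ : ℂ) + q)

theorem tendsto_root_div (hq : 0 < q.re) :
    Tendsto (fun τ : ℝ => root q τ / ((τ : ℂ) + q)) atTop (𝓝 1) := by
  rw [tendsto_iff_norm_sub_tendsto_zero]
  refine squeeze_zero' (Eventually.of_forall fun _ => by positivity) ?_
    (tendsto_norm_mul_root_div_sub_one hq)
  filter_upwards [(tendsto_norm_add_atTop q).eventually_ge_atTop 1] with τ hτ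
  exact le_mul_of_one_le_left (norm_nonneg _) hτ

theorem continuousWithinAt_root_div (hq : 0 < q.re) :
    ContinuousWithinAt (fun τ : ℝ => root q τ / ((τ : ℂ) + q)) (Set.Ici 0) 0 := by
  refine (continuousOn_root hq 0 Set.self_mem_Ici).div (by fun_prop) ?_
  simpa using ne_zero_of_re_pos hq

theorem laplaceIntegrable_one : LaplaceIntegrable 0 (fun _ => 1) := by
  refine ⟨by fun_prop, fun ε hε => ?_⟩
  simpa using! integrableOn_rpow_mul_exp (s := 0) (by norm_num) hε

theorem integral_id_mul_exp {p : ℂ} (hp : 0 < p.re) :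
    ∫ r in Set.Ioi (0 : ℝ), (r : ℂ) * Complex.exp (-(p * r)) = (p ^ 2)⁻¹ := by
  have h1 := laplaceIntegrable_one.hasDerivAt le_rfl hp
  have h2 : (fun p : ℂ => ∫ r in Set.Ioi (0 : ℝ), 1 * Complex.exp (-(p * r))) =ᶠ[𝓝 p]
      fun p => p⁻¹ := by
    have : ∀ᶠ s : ℂ in 𝓝 p, 0 < s.re :=
      (isOpen_lt continuous_const Complex.continuous_re).mem_nhds hp
    filter_upwards [this] with s hs
    simp only [one_mul]
    rw [integral_exp_Ioi hs]; simp
  have h3 := (h1.congr_of_eventuallyEq h2.symm).unique (hasDerivAt_inv (ne_zero_of_re_pos hp))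
  simpa using h3

theorem integrableOn_id_weight (hq : 0 < q.re) :
    IntegrableOn (fun r : ℝ => ‖(r : ℂ)‖ * (r ^ (-(1 / 2) : ℝ) * Real.exp (-(q.re * r))))
      (Set.Ioi 0) := by
  refine (integrableOn_congr_fun (fun r hr => ?_) measurableSet_Ioi).1
    (integrableOn_rpow_mul_exp (s := 1 / 2) (by norm_num) hq)
  have hr : 0 < r := hr
  rw [Complex.norm_real, Real.norm_of_nonneg hr.le, ← mul_assoc]
  congr 1
  nth_rewrite 2 [← Real.rpow_one r]
  rw [← Real.rpow_add hr]; norm_num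

theorem integrableOn_id_mul_log_weight (hq : 0 < q.re) :
    IntegrableOn (fun r : ℝ => ‖(r : ℂ) * (Real.log r : ℂ)‖ *
      (r ^ (-(1 / 2) : ℝ) * Real.exp (-(q.re * r)))) (Set.Ioi 0) := by
  have h1 := (integrableOn_rpow_mul_exp (s := 0) (by norm_num) hq).const_mul 2
  have h2 := integrableOn_rpow_mul_exp (s := 3 / 2) (by norm_num) hq
  refine Integrable.mono' (h1.add h2) (by fun_prop : Measurable _).aestronglyMeasurable ?_
  filter_upwards [ae_restrict_mem measurableSet_Ioi] with r hr
  have hr : 0 < r := hr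
  have h3 := abs_log_le hr
  have h4 : r * r ^ (-(1 / 2) : ℝ) = r ^ (1 / 2 : ℝ) := by
    nth_rewrite 1 [← Real.rpow_one r]
    rw [← Real.rpow_add hr]; norm_num
  have h5 : r ^ (1 / 2 : ℝ) * r ^ (-(1 / 2) : ℝ) = 1 := by
    rw [← Real.rpow_add hr]; norm_num
  have h6 : r ^ (1 / 2 : ℝ) * r = r ^ (3 / 2 : ℝ) := by
    nth_rewrite 2 [← Real.rpow_one r]
    rw [← Real.rpow_add hr]; norm_num
  rw [Real.norm_of_nonneg (by positivity), norm_mul, Complex.norm_real, Complex.norm_real,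
    Real.norm_of_nonneg hr.le, Real.norm_eq_abs, Pi.add_apply, Real.rpow_zero]
  calc r * |Real.log r| * (r ^ (-(1 / 2) : ℝ) * Real.exp (-(q.re * r)))
      = (r ^ (1 / 2 : ℝ) * |Real.log r|) * Real.exp (-(q.re * r)) := by rw [← h4]; ring
    _ ≤ (r ^ (1 / 2 : ℝ) * (2 * r ^ (-(1 / 2) : ℝ) + r)) * Real.exp (-(q.re * r)) := by gcongr
    _ = _ := by rw [mul_add, h6, mul_left_comm, h5]; ring

/-- `∫₀^∞ r h(r) dr = 1 / (2π q²)`, since `root / p` is an antiderivative of `q² / (p² root)`. -/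
theorem integral_id_mul_hankelKernel (hq : 0 < q.re) :
    IntegrableOn (fun r : ℝ => (r : ℂ) * hankelKernel (Complex.I * q * r)) (Set.Ioi 0) ∧
    q ^ 2 * ∫ r in Set.Ioi (0 : ℝ), (r : ℂ) * hankelKernel (Complex.I * q * r) =
      1 / (2 * Real.pi) := by
  obtain ⟨h1, h2, h3⟩ := integral_mul_hankelKernel hq le_rfl (φ := fun r : ℝ => (r : ℂ))
    (by fun_prop) (integrableOn_id_weight hq)
  refine ⟨h1, ?_⟩
  have hd := integral_Ioi_of_hasDerivAt_of_tendsto (a := 0)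
    (continuousWithinAt_root_div hq) (fun τ hτ => hasDerivAt_root_div hq hτ) ?_
    (tendsto_root_div hq)
  · rw [h3, mul_left_comm, ← integral_const_mul]
    simp only [root_zero, zero_div, sub_zero] at hd
    nth_rewrite 2 [← mul_one (1 / (2 * (Real.pi : ℂ)))]
    rw [← hd]
    congr 1
    refine setIntegral_congr_fun measurableSet_Ioi fun τ hτ => ?_
    simp only [integral_id_mul_exp (add_re_pos hq (le_of_lt hτ))]
    simp only [div_eq_mul_inv, mul_inv]
  · refine (integrableOn_congr_fun (fun τ hτ => ?_) measurableSet_Ioi).1 (h2.const_mul (q ^ 2))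
    simp only [integral_id_mul_exp (add_re_pos hq (le_of_lt hτ))]
    simp only [div_eq_mul_inv, mul_inv]

/-- `root / p` is never a real number `≤ -1`, because `root` has nonnegative real part. -/
theorem one_add_root_div_mem_slitPlane (hq : 0 < q.re) {τ : ℝ} (hτ : 0 ≤ τ) :
    1 + root q τ / ((τ : ℂ) + q) ∈ Complex.slitPlane := by
  by_contra h
  rw [Complex.mem_slitPlane_iff, not_or, not_not] at h
  have hp := add_re_pos hq hτ
  set y := root q τ / ((τ : ℂ) + q) with hy
  have h1 : root q τ = y * ((τ : ℂ) + q) := by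
    rw [hy, div_mul_cancel₀ _ (ne_zero_of_re_pos hp)]
  have h2 : y.re ≤ -1 := by
    have := h.1
    simp only [Complex.add_re, Complex.one_re] at this
    linarith
  have h3 : y.im = 0 := by simpa using h.2
  have h4 := root_re_nonneg q τ
  rw [h1, Complex.mul_re, h3] at h4
  nlinarith

theorem integral_id_mul_log_mul_exp {p : ℂ} (hp : 0 < p.re) :
    ∫ r in Set.Ioi (0 : ℝ), (r : ℂ) * (Real.log r : ℂ) * Complex.exp (-(p * r)) =
      (1 - (Real.eulerMascheroniConstant : ℂ) - Complex.log p) * (p ^ 2)⁻¹ := by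
  have h1 := laplace_id_mul_log le_rfl one_pos (by simp)
      (by simpa using laplaceIntegrable_log) hp
  simp only [div_one, Complex.ofReal_zero, mul_zero, neg_zero, Complex.exp_zero] at h1
  rw [integral_log_mul_exp hp] at h1
  have := ne_zero_of_re_pos hp
  rw [eq_mul_inv_iff_mul_eq₀ (pow_ne_zero 2 this)]
  linear_combination h1

/-- An antiderivative of `q² (1 - γ - log p) / (p² root)`, where `p = τ + q`. -/
def logPrimitive (q : ℂ) (τ : ℝ) : ℂ :=
  -(Real.eulerMascheroniConstant : ℂ) * (root q τ / ((τ : ℂ) + q))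
    - Complex.log ((τ : ℂ) + q) * (root q τ / ((τ : ℂ) + q) - 1)
    + Complex.log (1 + root q τ / ((τ : ℂ) + q))

theorem hasDerivAt_logPrimitive (hq : 0 < q.re) {τ : ℝ} (hτ : 0 < τ) :
    HasDerivAt (logPrimitive q) (q ^ 2 * ((1 - (Real.eulerMascheroniConstant : ℂ)
      - Complex.log ((τ : ℂ) + q)) * (((τ : ℂ) + q) ^ 2)⁻¹ / root q τ)) τ := by
  have d0 : HasDerivAt (fun r : ℝ => (r : ℂ)) 1 τ := Complex.ofRealCLM.hasDerivAt
  have hpr := add_re_pos hq hτ.le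
  have hp := ne_zero_of_re_pos hpr
  have hr := root_ne_zero hq hτ
  have hs := one_add_root_div_mem_slitPlane hq hτ.le
  have hs0 := Complex.slitPlane_ne_zero hs
  have d1 := hasDerivAt_root_div hq hτ
  have d2 : HasDerivAt (fun τ : ℝ => Complex.log ((τ : ℂ) + q)) (1 / ((τ : ℂ) + q)) τ :=
    (d0.add_const q).clog_real (Or.inl hpr)
  have d3 := (d1.const_add 1).clog_real hs
  convert! ((d1.const_mul (-(Real.eulerMascheroniConstant : ℂ))).sub
    (d2.mul (d1.sub_const 1))).add d3 using 1
  have hsq := root_sq q hτ.le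
  have hs1 : (τ : ℂ) + q + root q τ ≠ 0 := by
    intro h
    apply hs0
    field_simp
    rw [h, mul_zero]
  generalize Complex.log ((τ : ℂ) + q) = l
  generalize (τ : ℂ) + q = p at *
  generalize root q τ = s at *
  have hq2 : q ^ 2 = p ^ 2 - s ^ 2 := by linear_combination hsq
  rw [hq2]
  field_simp
  ring

theorem continuousWithinAt_logPrimitive (hq : 0 < q.re) :
    ContinuousWithinAt (logPrimitive q) (Set.Ici 0) 0 := by
  have h1 := continuousWithinAt_root_div hq
  have h2 : ContinuousWithinAt (fun τ : ℝ => Complex.log ((τ : ℂ) + q)) (Set.Ici 0) 0 :=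
    (by fun_prop : Continuous fun τ : ℝ => (τ : ℂ) + q).continuousWithinAt.clog
      (Or.inl (add_re_pos hq le_rfl))
  have h3 := (continuousWithinAt_const (b := (1 : ℂ))).add h1 |>.clog
    (one_add_root_div_mem_slitPlane hq le_rfl)
  exact ((continuousWithinAt_const.mul h1).sub (h2.mul (h1.sub continuousWithinAt_const))).add h3

theorem tendsto_logPrimitive (hq : 0 < q.re) :
    Tendsto (logPrimitive q) atTop
      (𝓝 (-(Real.eulerMascheroniConstant : ℂ) + Complex.log 2)) := by
  have h1 := tendsto_root_div hq
  have h2 : Tendsto (fun τ : ℝ => Complex.log ((τ : ℂ) + q) *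
      (root q τ / ((τ : ℂ) + q) - 1)) atTop (𝓝 0) := by
    refine squeeze_zero_norm' ?_
      (by simpa using (tendsto_norm_mul_root_div_sub_one hq).const_mul (1 + Real.pi))
    filter_upwards [(tendsto_norm_add_atTop q).eventually_ge_atTop 1] with τ hτ
    have h3 : ‖Complex.log ((τ : ℂ) + q)‖ ≤ (1 + Real.pi) * ‖(τ : ℂ) + q‖ := by
      have h4 := Complex.norm_le_abs_re_add_abs_im (Complex.log ((τ : ℂ) + q))
      rw [Complex.log_re, Complex.log_im, abs_of_nonneg (Real.log_nonneg hτ)] at h4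
      have h5 := Complex.abs_arg_le_pi ((τ : ℂ) + q)
      have h6 := Real.log_le_sub_one_of_pos (by linarith : 0 < ‖(τ : ℂ) + q‖)
      nlinarith [Real.pi_pos]
    rw [norm_mul]
    calc _ ≤ (1 + Real.pi) * ‖(τ : ℂ) + q‖ * ‖root q τ / ((τ : ℂ) + q) - 1‖ := by gcongr
      _ = _ := by ring
  have h3 : Tendsto (fun τ : ℝ => Complex.log (1 + root q τ / ((τ : ℂ) + q))) atTop
      (𝓝 (Complex.log (1 + 1))) := (h1.const_add 1).clog (Or.inl (by norm_num))
  have h4 := ((h1.const_mul (-(Real.eulerMascheroniConstant : ℂ))).sub h2).add h3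
  convert! h4 using 2
  norm_num

/-- The moment `∫₀^∞ r log r h(r) dr` of the radial profile `h` of the free kernel. -/
theorem integral_id_mul_log_mul_hankelKernel (hq : 0 < q.re) :
    IntegrableOn (fun r : ℝ => (r : ℂ) * (Real.log r : ℂ) * hankelKernel (Complex.I * q * r))
      (Set.Ioi 0) ∧
    q ^ 2 * ∫ r in Set.Ioi (0 : ℝ), (r : ℂ) * (Real.log r : ℂ) *
      hankelKernel (Complex.I * q * r) =
      1 / (2 * Real.pi) *
        (-(Real.eulerMascheroniConstant : ℂ) + Complex.log 2 - Complex.log q) := by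
  obtain ⟨h1, h2, h3⟩ := integral_mul_hankelKernel hq le_rfl
    (φ := fun r : ℝ => (r : ℂ) * (Real.log r : ℂ)) (by fun_prop) (integrableOn_id_mul_log_weight hq)
  refine ⟨h1, ?_⟩
  have e : ∀ τ ∈ Set.Ioi (0 : ℝ), q ^ 2 * ((∫ r in Set.Ioi (0 : ℝ), (r : ℂ) * (Real.log r : ℂ) *
      Complex.exp (-(((τ : ℂ) + q) * r))) / root q τ) = q ^ 2 * ((1 -
      (Real.eulerMascheroniConstant : ℂ) - Complex.log ((τ : ℂ) + q)) *
        (((τ : ℂ) + q) ^ 2)⁻¹ / root q τ) := by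
    intro τ hτ
    rw [integral_id_mul_log_mul_exp (add_re_pos hq (le_of_lt hτ))]
  have hd := integral_Ioi_of_hasDerivAt_of_tendsto (a := 0)
    (continuousWithinAt_logPrimitive hq) (fun τ hτ => hasDerivAt_logPrimitive hq hτ)
    ((integrableOn_congr_fun e measurableSet_Ioi).1 (h2.const_mul _)) (tendsto_logPrimitive hq)
  rw [h3, mul_left_comm, ← integral_const_mul, setIntegral_congr_fun measurableSet_Ioi e, hd]
  congr 1
  simp [logPrimitive, root_zero]

theorem exists_norm_laplace_log_le {ρ : ℝ} (hρ : 0 < ρ) (hq : 0 < q.re) :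
    ∃ C : ℝ, ∀ τ : ℝ, 0 ≤ τ → ‖∫ r in Set.Ioi ρ, (Real.log (r / ρ) : ℂ) *
      Complex.exp (-(((τ : ℂ) + q) * r))‖ ≤ C * Real.exp (-(ρ * τ)) := by
  have h := (laplaceIntegrable_log_div hρ).2 _ hq
  refine ⟨∫ r in Set.Ioi ρ, ‖(Real.log (r / ρ) : ℂ)‖ * Real.exp (-(q.re * r)), fun τ hτ => ?_⟩
  rw [← integral_mul_const]
  refine norm_integral_le_of_norm_le (h.mul_const _) ?_
  filter_upwards [ae_restrict_mem measurableSet_Ioi] with r hr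
  have hr : ρ < r := hr
  rw [norm_mul, norm_cexp_neg_mul, mul_assoc, ← Real.exp_add]
  gcongr
  simp only [Complex.add_re, Complex.ofReal_re]
  nlinarith

theorem norm_root_le (q : ℂ) {τ : ℝ} (hτ : 0 ≤ τ) : ‖root q τ‖ ≤ τ + 2 * ‖q‖ := by
  have h1 := norm_root_sq q hτ
  have h2 : ‖(τ : ℂ) / 2 + q‖ ≤ τ / 2 + ‖q‖ := by
    refine (norm_add_le _ _).trans ?_
    simp [abs_of_nonneg hτ]
  have h3 := norm_nonneg q
  refine abs_le_of_sq_le_sq' ?_ (by positivity) |>.2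
  rw [h1]
  nlinarith

/-- `∫_{r > ρ} r log (r / ρ) h(r) dr = h(ρ) / q²` for the radial profile `h` of the free kernel. In
terms of `W = ∫_{r > ρ} log (r / ρ) e^{-pr} dr` and `L = -W'` the difference of the
two sides is, up to the factor `1 / (2π)`, the integral of `(root W)' = (q² L - e^{-pρ}) / root`; the
latter formula is `laplace_id_mul_log`. -/
theorem integral_id_mul_log_div_mul_hankelKernel (hq : 0 < q.re) {ρ : ℝ} (hρ : 0 < ρ) :
    IntegrableOn (fun r : ℝ => (r : ℂ) * (Real.log (r / ρ) : ℂ) *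
      hankelKernel (Complex.I * q * r)) (Set.Ioi ρ) ∧
    q ^ 2 * ∫ r in Set.Ioi ρ, (r : ℂ) * (Real.log (r / ρ) : ℂ) *
      hankelKernel (Complex.I * q * r) = hankelKernel (Complex.I * q * ρ) := by
  have hL := laplaceIntegrable_log_div hρ
  have hint : IntegrableOn (fun r : ℝ => ‖(r : ℂ) * (Real.log (r / ρ) : ℂ)‖ *
      (r ^ (-(1 / 2) : ℝ) * Real.exp (-(q.re * r)))) (Set.Ioi ρ) := by
    refine Integrable.mono' (((hL.id_mul hρ.le).2 _ hq).const_mul (ρ ^ (-(1 / 2) : ℝ)))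
      (by fun_prop : Measurable _).aestronglyMeasurable ?_
    filter_upwards [ae_restrict_mem measurableSet_Ioi] with r hr
    have hr : ρ < r := hr
    have hr0 : 0 < r := hρ.trans hr
    rw [Real.norm_of_nonneg (by positivity)]
    have : r ^ (-(1 / 2) : ℝ) ≤ ρ ^ (-(1 / 2) : ℝ) :=
      Real.rpow_le_rpow_of_nonpos hρ hr.le (by norm_num)
    calc _ ≤ ‖(r : ℂ) * (Real.log (r / ρ) : ℂ)‖ *
          (ρ ^ (-(1 / 2) : ℝ) * Real.exp (-(q.re * r))) := by gcongr
      _ = _ := by ring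
  obtain ⟨h1, h2, h3⟩ := integral_mul_hankelKernel hq hρ.le
    (φ := fun r : ℝ => (r : ℂ) * (Real.log (r / ρ) : ℂ)) (by fun_prop) hint
  refine ⟨h1, ?_⟩
  rw [h3, hankelKernel_eq_laplace hq hρ, mul_left_comm, ← integral_const_mul]
  congr 1
  set L : ℝ → ℂ := fun τ => ∫ r in Set.Ioi ρ, (r : ℂ) * (Real.log (r / ρ) : ℂ) *
    Complex.exp (-(((τ : ℂ) + q) * r)) with hLdef
  set W : ℝ → ℂ := fun τ => ∫ r in Set.Ioi ρ, (Real.log (r / ρ) : ℂ) *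
    Complex.exp (-(((τ : ℂ) + q) * r)) with hWdef
  have dW : ∀ τ : ℝ, 0 ≤ τ → HasDerivAt W (-L τ) τ := by
    intro τ hτ
    have := (hL.hasDerivAt hρ.le (add_re_pos hq hτ)).comp_add_const (τ : ℂ) q
    exact this.comp_ofReal
  have i2 : IntegrableOn (fun τ : ℝ => Complex.exp (-(((τ : ℂ) + q) * ρ)) / root q τ)
      (Set.Ioi 0) := by
    refine Integrable.mono' (((integrableOn_rpow_mul_exp (s := -(1 / 2)) (by norm_num) hρ).const_mul
      (Real.sqrt (2 * q.re))⁻¹).const_mul (Real.exp (-(q.re * ρ)))) ?_ ?_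
    · have := measurable_root (q := q)
      exact (by fun_prop : Measurable _).aestronglyMeasurable
    · filter_upwards [ae_restrict_mem measurableSet_Ioi] with τ hτ
      exact norm_laplace_integrand_le hq hτ
  have j1 : IntegrableOn (fun τ : ℝ => q ^ 2 * (L τ / root q τ)) (Set.Ioi 0) := h2.const_mul _
  have hd := integral_Ioi_of_hasDerivAt_of_tendsto (a := 0) (m := 0)
    (f := fun τ => root q τ * W τ)
    (f' := fun τ => q ^ 2 * (L τ / root q τ) - Complex.exp (-(((τ : ℂ) + q) * ρ)) / root q τ)
    ((continuousOn_root hq 0 Set.self_mem_Ici).mul (dW 0 le_rfl).continuousAt.continuousWithinAt)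
    ?_ (j1.sub i2) ?_
  · rw [integral_sub j1 i2, root_zero, zero_mul, sub_zero] at hd
    exact sub_eq_zero.1 hd
  · intro τ hτ
    have hτ : 0 < τ := hτ
    convert! (hasDerivAt_root hq hτ).mul (dW τ hτ.le) using 1
    have hr := root_ne_zero hq hτ
    have h4 := laplace_id_mul_log hρ.le hρ (by simp [hρ.ne']) hL (add_re_pos hq hτ.le)
    have h5 := root_sq q hτ.le
    change _ * L τ = _ * W τ + _ at h4
    field_simp
    rw [h5]
    linear_combination h4
  · obtain ⟨C, hC⟩ := exists_norm_laplace_log_le hρ hq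
    have t1 : Tendsto (fun τ : ℝ => τ * Real.exp (-ρ * τ)) atTop (𝓝 0) := by
      simpa using tendsto_rpow_mul_exp_neg_mul_atTop_nhds_zero 1 ρ hρ
    have t2 : Tendsto (fun τ : ℝ => Real.exp (-ρ * τ)) atTop (𝓝 0) := by
      simpa using tendsto_rpow_mul_exp_neg_mul_atTop_nhds_zero 0 ρ hρ
    have t3 : Tendsto (fun τ : ℝ => (τ * Real.exp (-ρ * τ) + 2 * ‖q‖ * Real.exp (-ρ * τ)) * C)
        atTop (𝓝 0) := by
      simpa using (t1.add (t2.const_mul (2 * ‖q‖))).mul_const C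
    refine squeeze_zero_norm' ?_ t3
    filter_upwards [eventually_ge_atTop 0] with τ hτ
    rw [norm_mul]
    calc ‖root q τ‖ * ‖W τ‖ ≤ (τ + 2 * ‖q‖) * (C * Real.exp (-(ρ * τ))) :=
          mul_le_mul (norm_root_le q hτ) (hC τ hτ) (norm_nonneg _) (by positivity)
      _ = _ := by rw [neg_mul]; ring

end

section

variable {q : ℂ}

/-! ### Radial integration against the logarithm -/

theorem integral_log_norm_sub_circle (a : ℂ) {r : ℝ} (hr : 0 < r) :
    ∫ θ in Set.Ioo (-Real.pi) Real.pi, Real.log ‖a - Complex.polarCoord.symm (r, θ)‖ =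
      2 * Real.pi * Real.log (max ‖a‖ r) := by
  have h1 := circleAverage_log_norm_sub_const_eq_log_radius_add_posLog (a := a) (c := 0) hr.ne'
  rw [Real.circleAverage, zero_sub, norm_neg, Real.posLog_eq_log_max_one (by positivity),
    ← Real.log_mul hr.ne' (by positivity), mul_max_of_nonneg _ _ hr.le, mul_one,
    mul_inv_cancel_left₀ hr.ne', max_comm, smul_eq_mul,
    inv_mul_eq_iff_eq_mul₀ (by positivity)] at h1
  rw [← h1, ← integral_Ioc_eq_integral_Ioo,
    ← intervalIntegral.integral_of_le (by linarith [Real.pi_pos])]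
  have hper : Function.Periodic (fun θ => Real.log ‖circleMap 0 r θ - a‖) (2 * Real.pi) := by
    intro θ
    simp only [periodic_circleMap 0 r θ]
  have h2 := hper.intervalIntegral_add_eq (-Real.pi) 0
  rw [zero_add, show -Real.pi + 2 * Real.pi = Real.pi by ring] at h2
  rw [← h2]
  refine intervalIntegral.integral_congr fun θ _ => ?_
  simp only [norm_sub_rev a, Complex.polarCoord_symm_apply, circleMap, zero_add,
    Complex.exp_mul_I, Complex.ofReal_cos, Complex.ofReal_sin]

/-- Newton's theorem in the plane, over `ℂ`. -/
theorem integral_radial_mul_log_complex {f : ℝ → ℂ} (hf : Measurable f) (a : ℂ)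
    (hint : Integrable fun w : ℂ => f ‖w‖ * (Real.log ‖a - w‖ : ℂ)) :
    ∫ w : ℂ, f ‖w‖ * (Real.log ‖a - w‖ : ℂ) =
      2 * Real.pi * ∫ r in Set.Ioi (0 : ℝ), (r : ℂ) * (Real.log (max ‖a‖ r) : ℂ) * f r := by
  set F : ℂ → ℂ := fun w => f ‖w‖ * (Real.log ‖a - w‖ : ℂ) with hF
  have hFm : Measurable F := by fun_prop
  have hsymm : Measurable (fun p : ℝ × ℝ => Complex.polarCoord.symm p) := by
    simp only [Complex.polarCoord_symm_apply]
    fun_prop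
  have hI : IntegrableOn (fun p : ℝ × ℝ => p.1 • F (Complex.polarCoord.symm p))
      (Set.Ioi 0 ×ˢ Set.Ioo (-Real.pi) Real.pi) := by
    refine ⟨(measurable_fst.smul (hFm.comp hsymm)).aestronglyMeasurable, ?_⟩
    have h := Complex.lintegral_comp_polarCoord_symm (fun w => ‖F w‖ₑ)
    rw [polarCoord_target] at h
    rw [hasFiniteIntegral_iff_enorm]
    refine lt_of_eq_of_lt ?_ hint.2
    rw [← h]
    refine setLIntegral_congr_fun (measurableSet_Ioi.prod measurableSet_Ioo) fun p hp => ?_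
    simp only [enorm_smul, smul_eq_mul]
    rw [Real.enorm_eq_ofReal (le_of_lt hp.1)]
  have h1 := Complex.integral_comp_polarCoord_symm F
  rw [polarCoord_target] at h1
  rw [← h1]
  rw [Measure.volume_eq_prod] at hI ⊢
  rw [setIntegral_prod _ hI, ← integral_const_mul]
  refine setIntegral_congr_fun measurableSet_Ioi fun r hr => ?_
  have hr : 0 < r := hr
  have h2 : ∀ θ : ℝ, r • F (Complex.polarCoord.symm (r, θ)) =
      ((r : ℂ) * f r) * ((Real.log ‖a - Complex.polarCoord.symm (r, θ)‖ : ℝ) : ℂ) := by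
    intro θ
    simp only [hF, Complex.norm_polarCoord_symm, abs_of_pos hr, Complex.real_smul, mul_assoc]
  simp only [h2]
  rw [integral_const_mul, integral_complex_ofReal, integral_log_norm_sub_circle a hr]
  push_cast
  ring

/-- The isometry of `ℂ` with the plane. -/
def complexIso : ℂ ≃ₗᵢ[ℝ] Plane := Complex.orthonormalBasisOneI.repr

/-- Newton's theorem: a radial density acts on the logarithmic potential through
`log (max ‖x‖ r)`. -/
theorem integral_radial_mul_log {f : ℝ → ℂ} (hf : Measurable f) (x : Plane)
    (hint : Integrable fun y : Plane => f ‖y‖ * (Real.log ‖x - y‖ : ℂ)) :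
    ∫ y : Plane, f ‖y‖ * (Real.log ‖x - y‖ : ℂ) =
      2 * Real.pi * ∫ r in Set.Ioi (0 : ℝ), (r : ℂ) * (Real.log (max ‖x‖ r) : ℂ) * f r := by
  have hmp : MeasurePreserving complexIso := complexIso.measurePreserving
  have hemb : MeasurableEmbedding complexIso := complexIso.toHomeomorph.measurableEmbedding
  have e1 : ∀ w : ℂ, f ‖complexIso w‖ * (Real.log ‖x - complexIso w‖ : ℂ) =
      f ‖w‖ * (Real.log ‖complexIso.symm x - w‖ : ℂ) := by
    intro w
    rw [complexIso.norm_map, ← complexIso.norm_map (complexIso.symm x - w), map_sub,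
      complexIso.apply_symm_apply]
  rw [← hmp.integral_comp hemb]
  simp only [e1]
  rw [integral_radial_mul_log_complex hf, complexIso.symm.norm_map]
  have := (hmp.integrable_comp_emb hemb).2 hint
  exact this.congr (Eventually.of_forall fun w => e1 w)

theorem integral_radial (f : ℝ → ℂ) :
    ∫ y : Plane, f ‖y‖ = 2 * Real.pi * ∫ r in Set.Ioi (0 : ℝ), (r : ℂ) * f r := by
  rw [integral_fun_norm_addHaar]
  simp [Measure.real, EuclideanSpace.volume_ball_fin_two, mul_assoc, Real.pi_pos.le]

theorem measurable_hankelKernel : Measurable hankelKernel := by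
  unfold hankelKernel
  refine Measurable.mul (by fun_prop) ?_
  have : StronglyMeasurable (Function.uncurry fun (w : ℂ) (t : ℝ) =>
      ((Real.exp (-t) * t ^ (-(1 / 2) : ℝ) : ℝ) : ℂ) *
        ((t : ℂ) / 2 - Complex.I * w) ^ (-(1 / 2) : ℂ)) := by
    refine Measurable.stronglyMeasurable ?_
    unfold Function.uncurry
    fun_prop
  exact (this.integral_prod_right (ν := volume.restrict (Set.Ioi 0))).measurable

theorem measurable_freeKernel (z : ℂ) : Measurable (freeKernel z) := by
  have := measurable_hankelKernel
  unfold freeKernel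
  fun_prop

/-! ### Moments of the free kernel -/

variable {z : ℂ}

theorem neg_I_mul_re (z : ℂ) : (-Complex.I * z).re = z.im := by simp

theorem I_mul_neg_I_mul (z : ℂ) : Complex.I * (-Complex.I * z) = z := by
  rw [← mul_assoc]; simp

theorem neg_I_mul_sq (z : ℂ) : (-Complex.I * z) ^ 2 = -z ^ 2 := by
  rw [mul_pow, neg_sq, Complex.I_sq]; ring

theorem norm_freeKernel_le (hz : 0 < z.im) : ∃ C : ℝ, ∀ x : Plane, x ≠ 0 →
    ‖freeKernel z x‖ ≤ C * (Real.exp (-(z.im * ‖x‖)) * ‖x‖ ^ (-(1 / 2) : ℝ)) := by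
  obtain ⟨C, hC⟩ := norm_hankelKernel_le (q := -Complex.I * z) (by simpa using hz)
  refine ⟨C, fun x hx => ?_⟩
  have := hC ‖x‖ (norm_pos_iff.2 hx)
  rwa [I_mul_neg_I_mul, neg_I_mul_re] at this

/-- `-z² G * 1 = 1`. -/
theorem integral_freeKernel (hz : 0 < z.im) : -z ^ 2 * ∫ y, freeKernel z y = 1 := by
  have h := (integral_id_mul_hankelKernel (q := -Complex.I * z) (by simpa using hz)).2
  simp only [I_mul_neg_I_mul, neg_I_mul_sq] at h
  have h1 := integral_radial fun r => hankelKernel (z * r)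
  unfold freeKernel
  have hpi : (Real.pi : ℂ) ≠ 0 := by exact_mod_cast Real.pi_ne_zero
  rw [h1, mul_left_comm, h]
  field_simp

theorem log_neg_I_mul (hz : 0 < z.im) :
    Complex.log (-Complex.I * z) = Complex.log (z / 2) + Complex.log 2 -
      Complex.I * Real.pi / 2 := by
  have hz0 : z ≠ 0 := by rintro rfl; simp at hz
  have h1 : Complex.log (-Complex.I * z) = Complex.log (-Complex.I) + Complex.log z := by
    refine (Complex.log_mul_eq_add_log_iff (by simp) hz0).2 ?_
    have h2 : 0 ≤ Complex.arg z := Complex.arg_nonneg_iff.2 hz.le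
    have h3 := Complex.arg_le_pi z
    rw [Complex.arg_neg_I]
    constructor <;> linarith [Real.pi_pos]
  have h4 : Complex.log (z / 2) = Complex.log z - Complex.log 2 := by
    have := Complex.log_ofReal_mul (r := 1 / 2) (by norm_num) hz0
    rw [show z / 2 = ((1 / 2 : ℝ) : ℂ) * z by push_cast; ring, this, one_div, Real.log_inv,
      Complex.ofReal_neg, Complex.ofReal_log zero_le_two]
    push_cast; ring
  rw [h1, h4, Complex.log_neg_I]
  ring

/-- The logarithmic moment of the free kernel at the origin is the constant `g z`. -/
theorem neg_sq_mul_integral_log_hankelKernel (hz : 0 < z.im) :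
    -z ^ 2 * ∫ r in Set.Ioi (0 : ℝ), (r : ℂ) * (Real.log r : ℂ) * hankelKernel (z * r) = g z := by
  have h := (integral_id_mul_log_mul_hankelKernel (q := -Complex.I * z) (by simpa using hz)).2
  simp only [I_mul_neg_I_mul, neg_I_mul_sq] at h
  have hpi : (Real.pi : ℂ) ≠ 0 := by exact_mod_cast Real.pi_ne_zero
  rw [h, log_neg_I_mul hz, g]
  field_simp
  ring

theorem neg_sq_mul_integral_log_max_hankelKernel (hz : 0 < z.im) {ρ : ℝ} (hρ : 0 < ρ) :
    -z ^ 2 * ∫ r in Set.Ioi (0 : ℝ), (r : ℂ) * (Real.log (max ρ r) : ℂ) * hankelKernel (z * r) =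
      1 / (2 * Real.pi) * (Real.log ρ : ℂ) + hankelKernel (z * ρ) := by
  have hq : 0 < (-Complex.I * z).re := by simpa using hz
  obtain ⟨i1, h1⟩ := integral_id_mul_hankelKernel hq
  obtain ⟨i2, h2⟩ := integral_id_mul_log_div_mul_hankelKernel hq hρ
  simp only [I_mul_neg_I_mul, neg_I_mul_sq] at i1 h1 i2 h2
  have e : ∀ r ∈ Set.Ioi (0 : ℝ), (r : ℂ) * (Real.log (max ρ r) : ℂ) * hankelKernel (z * r) =
      (Real.log ρ : ℂ) * ((r : ℂ) * hankelKernel (z * r)) +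
      (Set.Ioi ρ).indicator (fun r : ℝ => (r : ℂ) * (Real.log (r / ρ) : ℂ) *
        hankelKernel (z * r)) r := by
    intro r hr
    have hr : 0 < r := hr
    by_cases h : ρ < r
    · rw [Set.indicator_of_mem (show r ∈ Set.Ioi ρ from h), max_eq_right h.le,
        Real.log_div hr.ne' hρ.ne']
      push_cast; ring
    · rw [Set.indicator_of_notMem (show r ∉ Set.Ioi ρ from h), max_eq_left (not_lt.1 h)]
      ring
  have i3 : IntegrableOn ((Set.Ioi ρ).indicator (fun r : ℝ => (r : ℂ) * (Real.log (r / ρ) : ℂ) *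
        hankelKernel (z * r))) (Set.Ioi 0) := by
    exact ((integrable_indicator_iff measurableSet_Ioi).2 i2).integrableOn
  have i4 : IntegrableOn (fun r : ℝ => (Real.log ρ : ℂ) * ((r : ℂ) * hankelKernel (z * r)))
    (Set.Ioi 0) := i1.const_mul _
  rw [setIntegral_congr_fun measurableSet_Ioi e, integral_add i4 i3, integral_const_mul,
    setIntegral_indicator measurableSet_Ioi,
    Set.inter_eq_right.2 (Set.Ioi_subset_Ioi hρ.le), mul_add, h2, mul_left_comm, h1]
  ring

end

section

/-! ### Convolution on weighted spaces -/

/-- The Japanese bracket `⟨x⟩ = (1 + |x|²)^{1/2}`. -/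
def bracket (x : Plane) : ℝ := Real.sqrt (1 + ‖x‖ ^ 2)

theorem bracket_pos (x : Plane) : 0 < bracket x := Real.sqrt_pos.2 (by positivity)

theorem one_le_bracket (x : Plane) : 1 ≤ bracket x := by
  rw [bracket, Real.one_le_sqrt]; nlinarith [sq_nonneg ‖x‖]

theorem bracket_le (x : Plane) : bracket x ≤ 1 + ‖x‖ := by
  rw [bracket, Real.sqrt_le_iff]
  constructor
  · positivity
  · nlinarith [norm_nonneg x]

theorem continuous_bracket : Continuous bracket := by unfold bracket; fun_prop

theorem measurable_bracket : Measurable bracket := continuous_bracket.measurable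

theorem bracket_neg (x : Plane) : bracket (-x) = bracket x := by simp [bracket]

theorem bracket_add_le (x y : Plane) : bracket (x + y) ≤ Real.sqrt 2 * (bracket x * bracket y) := by
  unfold bracket
  rw [← Real.sqrt_mul (by positivity), ← Real.sqrt_mul (by positivity)]
  refine Real.sqrt_le_sqrt ?_
  have h := norm_add_le x y
  have h1 : ‖x + y‖ ^ 2 ≤ (‖x‖ + ‖y‖) ^ 2 := by gcongr
  nlinarith [sq_nonneg (‖x‖ - ‖y‖), mul_nonneg (sq_nonneg ‖x‖) (sq_nonneg ‖y‖)]

theorem bracket_rpow_add_le {s : ℝ} (hs : 0 ≤ s) (x y : Plane) :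
    bracket (x + y) ^ s ≤ Real.sqrt 2 ^ s * (bracket x ^ s * bracket y ^ s) := by
  have hx := (bracket_pos x).le
  have hy := (bracket_pos y).le
  rw [← Real.mul_rpow hx hy, ← Real.mul_rpow (by positivity) (by positivity)]
  exact Real.rpow_le_rpow (bracket_pos _).le (bracket_add_le x y) hs

/-- Peetre's inequality. -/
theorem bracket_rpow_neg_le {s : ℝ} (hs : 0 ≤ s) (x y : Plane) :
    bracket x ^ (-s) ≤ Real.sqrt 2 ^ s * (bracket (x - y) ^ s * bracket y ^ (-s)) := by
  have h := bracket_rpow_add_le hs (y - x) x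
  rw [sub_add_cancel, ← neg_sub x y, bracket_neg] at h
  have hx := Real.rpow_pos_of_pos (bracket_pos x) s
  have hy := Real.rpow_pos_of_pos (bracket_pos y) s
  rw [Real.rpow_neg (bracket_pos x).le, Real.rpow_neg (bracket_pos y).le, ← mul_assoc,
    ← div_eq_mul_inv, le_div_iff₀ hy, inv_mul_le_iff₀ hx]
  linarith

theorem weighted_apply (s : ℝ) (u : Plane → ℂ) (x : Plane) :
    weighted s u x = ((bracket x ^ s : ℝ) : ℂ) * u x := rfl

theorem norm_weighted (s : ℝ) (u : Plane → ℂ) (x : Plane) :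
    ‖weighted s u x‖ = bracket x ^ s * ‖u x‖ := by
  have := bracket_pos x
  rw [weighted_apply, norm_mul, Complex.norm_real, Real.norm_of_nonneg (by positivity)]

theorem aestronglyMeasurable_weighted {s : ℝ} {u : Plane → ℂ} (hu : AEStronglyMeasurable u) :
    AEStronglyMeasurable (weighted s u) := by
  have : Measurable fun x => ((bracket x ^ s : ℝ) : ℂ) := by
    have := measurable_bracket
    fun_prop
  exact this.aestronglyMeasurable.mul hu

theorem weighted_weighted_neg (s : ℝ) (u : Plane → ℂ) : weighted (-s) (weighted s u) = u := by
  ext x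
  have := bracket_pos x
  rw [weighted_apply, weighted_apply, ← mul_assoc, ← Complex.ofReal_mul,
    ← Real.rpow_add this]
  simp

theorem MemWeightedL2.aestronglyMeasurable {s : ℝ} {u : Plane → ℂ} (hu : MemWeightedL2 s u) :
    AEStronglyMeasurable u := by
  rw [← weighted_weighted_neg s u]
  exact aestronglyMeasurable_weighted hu.1

theorem weighted_add (s : ℝ) (u v : Plane → ℂ) :
    weighted s (fun x => u x + v x) = weighted s u + weighted s v := by
  ext x; simp only [weighted_apply, Pi.add_apply]; ring

theorem weighted_const_mul (s : ℝ) (c : ℂ) (u : Plane → ℂ) :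
    weighted s (fun x => c * u x) = fun x => c * weighted s u x := by
  ext x; simp only [weighted_apply]; ring

theorem MemWeightedL2.add {s : ℝ} {u v : Plane → ℂ} (hu : MemWeightedL2 s u)
    (hv : MemWeightedL2 s v) : MemWeightedL2 s (fun x => u x + v x) := by
  rw [MemWeightedL2, weighted_add]; exact MemLp.add hu hv

theorem MemWeightedL2.const_mul {s : ℝ} {u : Plane → ℂ} (hu : MemWeightedL2 s u) (c : ℂ) :
    MemWeightedL2 s (fun x => c * u x) := by
  rw [MemWeightedL2, weighted_const_mul]; exact MemLp.const_mul hu c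

theorem MemWeightedL2.sub {s : ℝ} {u v : Plane → ℂ} (hu : MemWeightedL2 s u)
    (hv : MemWeightedL2 s v) : MemWeightedL2 s (fun x => u x - v x) := by
  simpa [sub_eq_add_neg] using hu.add (hv.const_mul (-1))

theorem MemWeightedL2.sum {s : ℝ} {ι : Type*} (t : Finset ι) {u : ι → Plane → ℂ}
    (hu : ∀ i ∈ t, MemWeightedL2 s (u i)) : MemWeightedL2 s (fun x => ∑ i ∈ t, u i x) := by
  classical
  induction t using Finset.induction_on with
  | empty =>
    have : weighted s (fun _ => 0) = fun _ => 0 := by ext x; simp [weighted_apply]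
    simp only [Finset.sum_empty, MemWeightedL2, this]
    exact MemLp.zero
  | insert i t hi ih =>
    simp only [Finset.sum_insert hi]
    exact (hu i (Finset.mem_insert_self i t)).add
      (ih fun j hj => hu j (Finset.mem_insert_of_mem hj))

theorem MemWeightedL2.congr_ae {s : ℝ} {u v : Plane → ℂ} (hu : MemWeightedL2 s u)
    (h : u =ᵐ[volume] v) : MemWeightedL2 s v :=
  (memLp_congr_ae (h.mono fun x hx => by simp only [weighted_apply, hx])).1 hu

theorem MemWeightedL2.norm {s : ℝ} {u : Plane → ℂ} (hu : MemWeightedL2 s u) :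
    MemWeightedL2 s (fun x => (‖u x‖ : ℂ)) := by
  refine MemLp.of_le hu (aestronglyMeasurable_weighted
    (Complex.continuous_ofReal.comp_aestronglyMeasurable hu.aestronglyMeasurable.norm)) ?_
  filter_upwards with x
  rw [norm_weighted, norm_weighted]
  simp

/-- A measurable convolution kernel which belongs, with the weight `⟨x⟩^s`, to `L¹` and `L²`. -/
structure WeightedKernel (s : ℝ) (A : Plane → ℂ) : Prop where
  measurable : Measurable A
  integrable : Integrable (weighted s A)
  memWeightedL2 : MemWeightedL2 s A

theorem WeightedKernel.norm {s : ℝ} {A : Plane → ℂ} (hA : WeightedKernel s A) :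
    WeightedKernel s (fun x => (‖A x‖ : ℂ)) where
  measurable := by have := hA.measurable; fun_prop
  integrable := by
    have hm := hA.measurable
    refine Integrable.mono hA.integrable (aestronglyMeasurable_weighted
      (by fun_prop : Measurable _).aestronglyMeasurable) ?_
    filter_upwards with x
    rw [norm_weighted, norm_weighted]
    simp
  memWeightedL2 := hA.memWeightedL2.norm

theorem integrable_rpow_mul_exp_norm {s ε : ℝ} (hs : -2 < s) (hε : 0 < ε) :
    Integrable (fun x : Plane => ‖x‖ ^ s * Real.exp (-(ε * ‖x‖))) := by
  have h := integrable_fun_norm_addHaar (E := Plane) (F := ℝ) (μ := volume)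
    (f := fun r => r ^ s * Real.exp (-(ε * r)))
  refine h.2 ?_
  refine (integrableOn_congr_fun (fun r hr => ?_) measurableSet_Ioi).1
    (integrableOn_rpow_mul_exp (s := s + 1) (by linarith) hε)
  have hr : 0 < r := hr
  simp only [finrank_euclideanSpace, Fintype.card_fin, smul_eq_mul, Real.rpow_add hr,
    Real.rpow_one]
  ring

theorem exists_bracket_rpow_le {s ε : ℝ} (hs : 0 < s) (hε : 0 < ε) :
    ∃ C : ℝ, 0 < C ∧ ∀ x, bracket x ^ s ≤ C * Real.exp (ε * ‖x‖) := by
  refine ⟨(1 + s / ε) ^ s, by positivity, fun x => ?_⟩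
  have h1 : bracket x ≤ (1 + s / ε) * Real.exp (ε / s * ‖x‖) := by
    have h2 : ε / s * ‖x‖ + 1 ≤ Real.exp (ε / s * ‖x‖) := Real.add_one_le_exp _
    have h3 : 0 ≤ ε / s * ‖x‖ := by positivity
    have h4 : s / ε * (ε / s * ‖x‖) = ‖x‖ := by field_simp
    have h5 : s / ε * (ε / s * ‖x‖) ≤ s / ε * Real.exp (ε / s * ‖x‖) := by gcongr; linarith
    have := bracket_le x
    linarith
  refine (Real.rpow_le_rpow (bracket_pos x).le h1 hs.le).trans_eq ?_
  rw [Real.mul_rpow (by positivity) (Real.exp_pos _).le, ← Real.exp_mul]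
  congr 2
  field_simp

/-- The point `0` is excluded since the bound vanishes there by convention (`0 ^ (-1/2) = 0`). -/
theorem WeightedKernel.of_norm_le {s κ C : ℝ} (hs : 0 < s) (hκ : 0 < κ) {A : Plane → ℂ}
    (hA : Measurable A)
    (h : ∀ x, x ≠ 0 → ‖A x‖ ≤ C * (Real.exp (-(κ * ‖x‖)) * ‖x‖ ^ (-(1 / 2) : ℝ))) :
    WeightedKernel s A := by
  obtain ⟨K, hK, hb⟩ := exists_bracket_rpow_le hs (half_pos hκ)
  have hne : ∀ᵐ x : Plane, x ≠ 0 := by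
    simp [ae_iff]
  have h1 : ∀ x, x ≠ 0 → ‖weighted s A x‖ ≤
      K * C * (‖x‖ ^ (-(1 / 2) : ℝ) * Real.exp (-(κ / 2 * ‖x‖))) := by
    intro x hx
    rw [norm_weighted]
    have e : Real.exp (-(κ / 2 * ‖x‖)) = Real.exp (κ / 2 * ‖x‖) * Real.exp (-(κ * ‖x‖)) := by
      rw [← Real.exp_add]; congr 1; ring
    calc bracket x ^ s * ‖A x‖ ≤ (K * Real.exp (κ / 2 * ‖x‖)) *
          (C * (Real.exp (-(κ * ‖x‖)) * ‖x‖ ^ (-(1 / 2) : ℝ))) :=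
          mul_le_mul (hb x) (h x hx) (norm_nonneg _) (by positivity)
      _ = _ := by rw [e]; ring
  have hm : AEStronglyMeasurable (weighted s A) :=
    aestronglyMeasurable_weighted hA.aestronglyMeasurable
  refine ⟨hA, ?_, ?_⟩
  · refine Integrable.mono' ((integrable_rpow_mul_exp_norm (s := -(1 / 2)) (by norm_num)
      (half_pos hκ)).const_mul (K * C)) hm ?_
    filter_upwards [hne] with x hx using h1 x hx
  · refine (memLp_two_iff_integrable_sq_norm hm).2 ?_
    refine Integrable.mono' ((integrable_rpow_mul_exp_norm (s := -1) (by norm_num)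
      hκ).const_mul ((K * C) ^ 2)) (hm.norm.pow 2) ?_
    filter_upwards [hne] with x hx
    have hx0 : 0 < ‖x‖ := norm_pos_iff.2 hx
    have e1 : (‖x‖ ^ (-(1 / 2) : ℝ)) ^ 2 = ‖x‖ ^ (-1 : ℝ) := by
      rw [← Real.rpow_natCast, ← Real.rpow_mul hx0.le]; norm_num
    have e2 : Real.exp (-(κ / 2 * ‖x‖)) ^ 2 = Real.exp (-(κ * ‖x‖)) := by
      rw [← Real.exp_nat_mul]; congr 1; push_cast; ring
    rw [norm_pow, norm_norm]
    calc ‖weighted s A x‖ ^ 2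
        ≤ (K * C * (‖x‖ ^ (-(1 / 2) : ℝ) * Real.exp (-(κ / 2 * ‖x‖)))) ^ 2 := by
          gcongr; exact h1 x hx
      _ = _ := by rw [mul_pow, mul_pow (‖x‖ ^ _), e1, e2]

/-- The convolution `A * f`. -/
def conv (A f : Plane → ℂ) (x : Plane) : ℂ := ∫ y, A (x - y) * f y

theorem conv_comm (A B : Plane → ℂ) (x : Plane) : conv A B x = conv B A x := by
  rw [conv, ← integral_sub_left_eq_self _ volume x]
  simp only [sub_sub_cancel, conv, mul_comm]

theorem conv_congr_ae {A f g : Plane → ℂ} (h : f =ᵐ[volume] g) (x : Plane) :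
    conv A f x = conv A g x :=
  integral_congr_ae (h.mono fun y hy => by simp only [hy])

theorem aestronglyMeasurable_uncurry_sub {A f : Plane → ℂ} (hA : Measurable A)
    (hf : AEStronglyMeasurable f) :
    AEStronglyMeasurable (fun p : Plane × Plane => A (p.1 - p.2) * f p.2)
      (volume.prod volume) :=
  (by fun_prop : Measurable fun p : Plane × Plane => A (p.1 - p.2)).aestronglyMeasurable.mul
    hf.comp_snd

theorem aestronglyMeasurable_conv {A f : Plane → ℂ} (hA : Measurable A)
    (hf : AEStronglyMeasurable f) : AEStronglyMeasurable (conv A f) :=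
  (aestronglyMeasurable_uncurry_sub hA hf).integral_prod_right'

theorem measurable_conv {A f : Plane → ℂ} (hA : Measurable A) (hf : Measurable f) :
    Measurable (conv A f) := by
  have : StronglyMeasurable (Function.uncurry fun x y : Plane => A (x - y) * f y) := by
    refine Measurable.stronglyMeasurable ?_
    unfold Function.uncurry
    fun_prop
  exact (this.integral_prod_right (ν := volume)).measurable

theorem WeightedKernel.memLp_translate {s : ℝ} (hs : 0 ≤ s) {A : Plane → ℂ}
    (hA : WeightedKernel s A) (x : Plane) : MemLp (weighted s fun y => A (x - y)) 2 := by
  have h1 : MemLp (fun y => weighted s A (x - y)) 2 :=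
    hA.memWeightedL2.comp_measurePreserving (Measure.measurePreserving_sub_left volume x)
  have hm := hA.measurable
  refine MemLp.of_le_mul (c := Real.sqrt 2 ^ s * bracket x ^ s) h1 (aestronglyMeasurable_weighted
    (by fun_prop : Measurable _).aestronglyMeasurable) ?_
  filter_upwards with y
  rw [norm_weighted, norm_weighted]
  have h2 := bracket_rpow_add_le hs x (-(x - y))
  rw [bracket_neg, show x + -(x - y) = y by abel] at h2
  calc bracket y ^ s * ‖A (x - y)‖
      ≤ Real.sqrt 2 ^ s * (bracket x ^ s * bracket (x - y) ^ s) * ‖A (x - y)‖ := by gcongr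
    _ = _ := by ring

theorem integrable_mul_of_weighted {s : ℝ} {u v : Plane → ℂ} (hu : MemWeightedL2 s u)
    (hv : MemWeightedL2 (-s) v) : Integrable (fun y => u y * v y) := by
  refine (MemLp.integrable_mul hu hv).congr (Eventually.of_forall fun y => ?_)
  have := bracket_pos y
  simp only [weighted_apply, Pi.mul_apply]
  rw [mul_mul_mul_comm, ← Complex.ofReal_mul, ← Real.rpow_add this]
  simp

/-- By Cauchy–Schwarz the convolution integral converges at every point. -/
theorem WeightedKernel.integrable_conv {s : ℝ} (hs : 0 ≤ s) {A f : Plane → ℂ}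
    (hA : WeightedKernel s A) (hf : MemWeightedL2 (-s) f) (x : Plane) :
    Integrable (fun y => A (x - y) * f y) :=
  integrable_mul_of_weighted (hA.memLp_translate hs x) hf

/-- The `L¹`–`L²` case of Young's convolution inequality. -/
theorem lintegral_sq_lconv_le {a b : Plane → ENNReal} (ha : Measurable a) (hb : AEMeasurable b) :
    ∫⁻ x, (∫⁻ y, a (x - y) * b y) ^ 2 ≤ (∫⁻ x, a x) ^ 2 * ∫⁻ x, b x ^ 2 := by
  have h1 : ∀ x, (∫⁻ y, a (x - y) * b y) ^ 2 ≤ (∫⁻ x, a x) * ∫⁻ y, a (x - y) * b y ^ 2 := by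
    intro x
    have h2 := ENNReal.lintegral_mul_le_Lp_mul_Lq volume
      (f := fun y => a (x - y) ^ (1 / 2 : ℝ)) (g := fun y => a (x - y) ^ (1 / 2 : ℝ) * b y)
      Real.HolderConjugate.two_two (by fun_prop) (by fun_prop)
    have e1 : ∀ c : ENNReal, c ^ (1 / 2 : ℝ) * c ^ (1 / 2 : ℝ) = c := fun c => by
      rw [← ENNReal.rpow_add_of_nonneg _ _ (by norm_num) (by norm_num)]; norm_num
    have e2 : ∀ c : ENNReal, (c ^ (1 / 2 : ℝ)) ^ (2 : ℝ) = c := fun c => by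
      rw [← ENNReal.rpow_mul]; norm_num
    simp only [Pi.mul_apply, ← mul_assoc, e1, e2, ENNReal.mul_rpow_of_nonneg _ _ zero_le_two,
      ENNReal.rpow_two] at h2
    have h3 := lintegral_sub_left_eq_self (μ := (volume : Measure Plane)) a x
    rw [h3] at h2
    have e3 : ∀ c : ENNReal, (c ^ (1 / 2 : ℝ)) ^ 2 = c := fun c => by
      rw [← ENNReal.rpow_two]; exact e2 c
    calc _ ≤ (((∫⁻ x, a x) ^ (1 / 2 : ℝ)) * (∫⁻ y, a (x - y) * b y ^ 2) ^ (1 / 2 : ℝ)) ^ 2 := by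
          gcongr
      _ = _ := by rw [mul_pow, e3, e3]
  calc _ ≤ ∫⁻ x, (∫⁻ x, a x) * ∫⁻ y, a (x - y) * b y ^ 2 := lintegral_mono h1
    _ ≤ (∫⁻ x, a x) * ∫⁻ x, ∫⁻ y, a (x - y) * b y ^ 2 := by
        rw [lintegral_const_mul'']
        exact AEMeasurable.lintegral_prod_right' (((by fun_prop : Measurable
          fun p : Plane × Plane => a (p.1 - p.2)).aemeasurable).mul ((hb.pow_const 2).comp_snd))
    _ = (∫⁻ x, a x) * ∫⁻ y, ∫⁻ x, a (x - y) * b y ^ 2 := by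
        rw [lintegral_lintegral_swap]
        exact ((by fun_prop : Measurable
          fun p : Plane × Plane => a (p.1 - p.2)).aemeasurable).mul ((hb.pow_const 2).comp_snd)
    _ = (∫⁻ x, a x) * ∫⁻ y, (∫⁻ x, a x) * b y ^ 2 := by
        congr 2; ext y
        rw [lintegral_mul_const _ (by fun_prop), lintegral_sub_right_eq_self]
    _ = _ := by rw [lintegral_const_mul'' _ (hb.pow_const 2)]; ring

/-- Convolution with a weighted kernel is bounded on `L²_{-s}`. -/
theorem WeightedKernel.weightedNorm_conv_le {s : ℝ} (hs : 0 ≤ s) {A : Plane → ℂ}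
    (hA : WeightedKernel s A) : ∃ C : ENNReal, C ≠ ⊤ ∧ ∀ f : Plane → ℂ, AEStronglyMeasurable f →
      weightedNorm (-s) (conv A f) ≤ C * weightedNorm (-s) f := by
  set K : ENNReal := ENNReal.ofReal (Real.sqrt 2 ^ s)
  refine ⟨K * ∫⁻ x, ‖weighted s A x‖ₑ, ENNReal.mul_ne_top ENNReal.ofReal_ne_top hA.integrable.2.ne,
    fun f hf => ?_⟩
  have hm : Measurable fun x => ‖weighted s A x‖ₑ := by
    have h1 := hA.measurable
    have h2 := measurable_bracket
    unfold weighted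
    fun_prop
  have hfm : AEMeasurable fun x => ‖weighted (-s) f x‖ₑ :=
    (aestronglyMeasurable_weighted hf).enorm
  have h1 : ∀ x, ‖weighted (-s) (conv A f) x‖ₑ ≤
      K * ∫⁻ y, ‖weighted s A (x - y)‖ₑ * ‖weighted (-s) f y‖ₑ := by
    intro x
    have h2 : ‖weighted (-s) (conv A f) x‖ₑ ≤
        ENNReal.ofReal (bracket x ^ (-s)) * ∫⁻ y, ‖A (x - y) * f y‖ₑ := by
      rw [weighted_apply, enorm_mul]
      gcongr
      · rw [← ofReal_norm, Complex.norm_real, Real.norm_of_nonneg]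
        exact Real.rpow_nonneg (bracket_pos x).le _
      · exact enorm_integral_le_lintegral_enorm _
    refine h2.trans ?_
    rw [← lintegral_const_mul' _ _ ENNReal.ofReal_ne_top,
      ← lintegral_const_mul' _ _ ENNReal.ofReal_ne_top]
    refine lintegral_mono fun y => ?_
    rw [← ofReal_norm (A (x - y) * f y), ← ofReal_norm (weighted s A (x - y)),
      ← ofReal_norm (weighted (-s) f y), norm_weighted, norm_weighted,
      ← ENNReal.ofReal_mul (Real.rpow_nonneg (bracket_pos x).le _),
      ← ENNReal.ofReal_mul (mul_nonneg (Real.rpow_nonneg (bracket_pos _).le _) (norm_nonneg _)),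
      ← ENNReal.ofReal_mul (by positivity)]
    refine ENNReal.ofReal_le_ofReal ?_
    rw [norm_mul]
    calc bracket x ^ (-s) * (‖A (x - y)‖ * ‖f y‖)
        ≤ Real.sqrt 2 ^ s * (bracket (x - y) ^ s * bracket y ^ (-s)) *
          (‖A (x - y)‖ * ‖f y‖) := by gcongr; exact bracket_rpow_neg_le hs x y
      _ = _ := by ring
  have h2 : ∀ u : Plane → ℂ, weightedNorm (-s) u =
      (∫⁻ x, ‖weighted (-s) u x‖ₑ ^ 2) ^ (1 / 2 : ℝ) := by
    intro u
    rw [weightedNorm, eLpNorm_eq_lintegral_rpow_enorm_toReal two_ne_zero ENNReal.ofNat_ne_top]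
    simp
  have e3 : ∀ c : ENNReal, (c ^ 2) ^ (1 / 2 : ℝ) = c := fun c => by
    rw [← ENNReal.rpow_two, ← ENNReal.rpow_mul]; norm_num
  rw [h2, h2]
  calc (∫⁻ x, ‖weighted (-s) (conv A f) x‖ₑ ^ 2) ^ (1 / 2 : ℝ)
      ≤ (∫⁻ x, K ^ 2 * (∫⁻ y, ‖weighted s A (x - y)‖ₑ * ‖weighted (-s) f y‖ₑ) ^ 2)
          ^ (1 / 2 : ℝ) := by
        gcongr with x
        rw [← mul_pow]
        gcongr
        exact h1 x
    _ ≤ (K ^ 2 * ((∫⁻ x, ‖weighted s A x‖ₑ) ^ 2 * ∫⁻ x, ‖weighted (-s) f x‖ₑ ^ 2))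
          ^ (1 / 2 : ℝ) := by
        rw [lintegral_const_mul' _ _ (ENNReal.pow_ne_top ENNReal.ofReal_ne_top)]
        gcongr
        exact lintegral_sq_lconv_le (a := fun x => ‖weighted s A x‖ₑ) hm hfm
    _ = _ := by
        rw [← mul_assoc, ← mul_pow, ENNReal.mul_rpow_of_nonneg _ _ (by norm_num), e3]

theorem WeightedKernel.memWeightedL2_conv {s : ℝ} (hs : 0 ≤ s) {A f : Plane → ℂ}
    (hA : WeightedKernel s A) (hf : MemWeightedL2 (-s) f) : MemWeightedL2 (-s) (conv A f) := by
  obtain ⟨C, hC, h⟩ := hA.weightedNorm_conv_le hs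
  refine ⟨aestronglyMeasurable_weighted (aestronglyMeasurable_conv hA.measurable
    hf.aestronglyMeasurable), ?_⟩
  exact (h f hf.aestronglyMeasurable).trans_lt (ENNReal.mul_lt_top hC.lt_top hf.2)

theorem WeightedKernel.integrable_uncurry {s : ℝ} (hs : 0 ≤ s) {A B f : Plane → ℂ}
    (hA : WeightedKernel s A) (hB : WeightedKernel s B) (hf : MemWeightedL2 (-s) f) (x : Plane) :
    Integrable (Function.uncurry fun y t : Plane => A (x - y) * (B (y - t) * f t))
      (volume.prod volume) := by
  have hfm := hf.aestronglyMeasurable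
  have hAm := hA.measurable
  refine (integrable_prod_iff ?_).2 ⟨?_, ?_⟩
  · exact ((by fun_prop : Measurable fun p : Plane × Plane =>
      A (x - p.1)).aestronglyMeasurable).mul
      (aestronglyMeasurable_uncurry_sub hB.measurable hfm)
  · exact Eventually.of_forall fun y => (hB.integrable_conv hs hf y).const_mul (A (x - y))
  · have h1 := hA.norm.integrable_conv hs (hB.norm.memWeightedL2_conv hs hf.norm) x
    refine h1.norm.congr (Eventually.of_forall fun y => ?_)
    have h2 : conv (fun x => (‖B x‖ : ℂ)) (fun x => (‖f x‖ : ℂ)) y =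
        ((∫ t, ‖B (y - t)‖ * ‖f t‖ : ℝ) : ℂ) := by
      rw [conv, ← integral_complex_ofReal]
      simp
    simp only [Function.uncurry, norm_mul, h2, Complex.norm_real, norm_norm, integral_const_mul]
    rw [Real.norm_of_nonneg (integral_nonneg fun t => by positivity)]

theorem integral_conv_integrand (A B f : Plane → ℂ) (x t : Plane) :
    ∫ y, A (x - y) * (B (y - t) * f t) = conv A B (x - t) * f t := by
  rw [conv, ← integral_mul_const,
    ← integral_add_right_eq_self (fun y => A (x - y) * (B (y - t) * f t)) t]
  congr 1; ext y
  rw [add_sub_cancel_right, mul_assoc, sub_add_eq_sub_sub_swap]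

theorem WeightedKernel.integrable_conv_conv {s : ℝ} (hs : 0 ≤ s) {A B f : Plane → ℂ}
    (hA : WeightedKernel s A) (hB : WeightedKernel s B) (hf : MemWeightedL2 (-s) f) (x : Plane) :
    Integrable (fun t => conv A B (x - t) * f t) :=
  (hA.integrable_uncurry hs hB hf x).integral_prod_right.congr
    (Eventually.of_forall fun t => integral_conv_integrand A B f x t)

/-- Associativity of convolution on `L²_{-s}`. -/
theorem WeightedKernel.conv_conv {s : ℝ} (hs : 0 ≤ s) {A B f : Plane → ℂ}
    (hA : WeightedKernel s A) (hB : WeightedKernel s B) (hf : MemWeightedL2 (-s) f) (x : Plane) :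
    conv A (conv B f) x = conv (conv A B) f x := by
  calc conv A (conv B f) x = ∫ y, ∫ t, A (x - y) * (B (y - t) * f t) := by
        simp only [conv, integral_const_mul]
    _ = ∫ t, ∫ y, A (x - y) * (B (y - t) * f t) :=
        integral_integral_swap (hA.integrable_uncurry hs hB hf x)
    _ = conv (conv A B) f x := by simp only [integral_conv_integrand]; rfl

end

section

/-! ### Elements of the weighted spaces -/

theorem MemWeightedL2.of_le {s : ℝ} {u v : Plane → ℂ} (hv : MemWeightedL2 s v)
    (hu : AEStronglyMeasurable u) (h : ∀ᵐ x : Plane, ‖u x‖ ≤ ‖v x‖) : MemWeightedL2 s u := by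
  refine MemLp.of_le hv (aestronglyMeasurable_weighted hu) ?_
  filter_upwards [h] with x hx
  rw [norm_weighted, norm_weighted]
  have := bracket_pos x
  gcongr

theorem MemWeightedL2.mono {s t : ℝ} (hst : s ≤ t) {u : Plane → ℂ} (hu : MemWeightedL2 t u) :
    MemWeightedL2 s u := by
  refine MemLp.of_le hu (aestronglyMeasurable_weighted hu.aestronglyMeasurable) ?_
  filter_upwards with x
  rw [norm_weighted, norm_weighted]
  gcongr
  exact one_le_bracket x

theorem MemLp.memWeightedL2_neg {s : ℝ} (hs : 0 ≤ s) {u : Plane → ℂ} (hu : MemLp u 2 volume) :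
    MemWeightedL2 (-s) u := by
  refine MemLp.of_le hu (aestronglyMeasurable_weighted hu.1) ?_
  filter_upwards with x
  rw [norm_weighted]
  exact mul_le_of_le_one_left (norm_nonneg _)
    (Real.rpow_le_one_of_one_le_of_nonpos (one_le_bracket x) (by linarith))

theorem memWeightedL2_bracket_rpow {s t : ℝ} (h : t + 1 < s) :
    MemWeightedL2 (-s) (fun x => ((bracket x ^ t : ℝ) : ℂ)) := by
  have hm : AEStronglyMeasurable (weighted (-s) (fun x => ((bracket x ^ t : ℝ) : ℂ))) := by
    refine aestronglyMeasurable_weighted ?_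
    have := measurable_bracket
    exact (by fun_prop : Measurable _).aestronglyMeasurable
  refine (memLp_two_iff_integrable_sq_norm hm).2 ?_
  have h1 := integrable_rpow_neg_one_add_norm_sq (E := Plane) (μ := volume) (r := 2 * (s - t))
    (by simp; linarith)
  refine h1.congr (Eventually.of_forall fun x => ?_)
  have hb := bracket_pos x
  simp only [norm_weighted, Complex.norm_real]
  rw [Real.norm_of_nonneg (by positivity), ← Real.rpow_add hb,
    ← Real.rpow_natCast (bracket x ^ _), ← Real.rpow_mul hb.le, bracket,
    Real.sqrt_eq_rpow, ← Real.rpow_mul (by positivity)]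
  congr 1
  push_cast; ring

theorem memWeightedL2_const {s : ℝ} (hs : 1 < s) (c : ℂ) :
    MemWeightedL2 (-s) (fun _ => c) := by
  have := (memWeightedL2_bracket_rpow (s := s) (t := 0) (by linarith)).const_mul c
  simpa using this

theorem ae_ne_zero : ∀ᵐ x : Plane, x ≠ 0 := by simp [ae_iff]

theorem memWeightedL2_log {s : ℝ} (hs : 1 < s) :
    MemWeightedL2 (-s) (fun x => (Real.log ‖x‖ : ℂ)) := by
  set ε : ℝ := (s - 1) / 2 with hε
  have hε0 : 0 < ε := by rw [hε]; linarith
  have h1 : WeightedKernel s (fun x : Plane =>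
      ((Real.exp (-(1 * ‖x‖)) * ‖x‖ ^ (-(1 / 2) : ℝ) : ℝ) : ℂ)) := by
    refine WeightedKernel.of_norm_le (C := 1) (by linarith) one_pos (by fun_prop) fun x _ => ?_
    rw [Complex.norm_real, Real.norm_of_nonneg (by positivity), one_mul (_ * _)]
  have h2 := ((h1.memWeightedL2.mono (by linarith : -s ≤ s)).const_mul
    ((2 * Real.exp 1 : ℝ) : ℂ)).add
    ((memWeightedL2_bracket_rpow (s := s) (t := ε) (by rw [hε]; linarith)).const_mul ((ε⁻¹ : ℝ) : ℂ))
  refine h2.of_le (by fun_prop : Measurable _).aestronglyMeasurable ?_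
  filter_upwards [ae_ne_zero] with x hx
  have hx0 : 0 < ‖x‖ := norm_pos_iff.2 hx
  have hb := bracket_pos x
  rw [← Complex.ofReal_mul, ← Complex.ofReal_mul, ← Complex.ofReal_add, Complex.norm_real,
    Complex.norm_real, Real.norm_of_nonneg (by positivity : (0 : ℝ) ≤ _ + _), Real.norm_eq_abs]
  rcases le_total ‖x‖ 1 with hle | hle
  · have h3 : 0 ≤ ε⁻¹ * bracket x ^ ε := by positivity
    have h4 : 1 ≤ Real.exp 1 * Real.exp (-(1 * ‖x‖)) := by
      rw [← Real.exp_add]; exact Real.one_le_exp (by linarith)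
    have h5 := Real.log_le_rpow_div (inv_pos.2 hx0).le (by norm_num : (0 : ℝ) < 1 / 2)
    rw [Real.log_inv, Real.inv_rpow hx0.le, ← Real.rpow_neg hx0.le] at h5
    rw [abs_of_nonpos (Real.log_nonpos hx0.le hle)]
    have h6 : 0 ≤ ‖x‖ ^ (-(1 / 2) : ℝ) := by positivity
    nlinarith
  · have h3 := Real.log_le_rpow_div hx0.le hε0
    have h4 : ‖x‖ ≤ bracket x := by
      rw [bracket]; exact Real.le_sqrt_of_sq_le (by linarith)
    have h5 : ‖x‖ ^ ε ≤ bracket x ^ ε := by gcongr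
    rw [abs_of_nonneg (Real.log_nonneg hle)]
    have h6 : ‖x‖ ^ ε / ε ≤ ε⁻¹ * bracket x ^ ε := by
      rw [div_eq_inv_mul]; gcongr
    have h7 : 0 ≤ 2 * Real.exp 1 * (Real.exp (-(1 * ‖x‖)) * ‖x‖ ^ (-(1 / 2) : ℝ)) := by positivity
    linarith

theorem MemWeightedL2.translate {s : ℝ} (hs : 0 ≤ s) {f : Plane → ℂ} (hf : MemWeightedL2 (-s) f)
    (a : Plane) : MemWeightedL2 (-s) (fun x => f (x - a)) := by
  have hmp := measurePreserving_sub_right (volume : Measure Plane) a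
  have h1 : MemLp (fun y => weighted (-s) f (y - a)) 2 := MemLp.comp_measurePreserving hf hmp
  refine MemLp.of_le_mul (c := Real.sqrt 2 ^ s * bracket a ^ s) h1 (aestronglyMeasurable_weighted
    (hf.aestronglyMeasurable.comp_measurePreserving hmp)) ?_
  filter_upwards with y
  rw [norm_weighted, norm_weighted]
  have h2 := bracket_rpow_neg_le hs y (y - a)
  rw [sub_sub_cancel] at h2
  calc bracket y ^ (-s) * ‖f (y - a)‖
      ≤ Real.sqrt 2 ^ s * (bracket a ^ s * bracket (y - a) ^ (-s)) * ‖f (y - a)‖ := by gcongr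
    _ = _ := by ring

theorem weightedKernel_freeKernel {s : ℝ} (hs : 0 < s) {z : ℂ} (hz : 0 < z.im) :
    WeightedKernel s (freeKernel z) := by
  obtain ⟨C, hC⟩ := norm_freeKernel_le hz
  exact WeightedKernel.of_norm_le hs hz (measurable_freeKernel z) hC

theorem WeightedKernel.of_norm_le_of_support {s R a b : ℝ} (hs : 0 < s) (hR0 : 0 < R)
    (ha : 0 ≤ a) (hb : 0 ≤ b)
    {A : Plane → ℂ} (hA : Measurable A) (h0 : ∀ x, R ≤ ‖x‖ → A x = 0)
    (h : ∀ x, x ≠ 0 → ‖x‖ < R → ‖A x‖ ≤ a * ‖x‖ ^ (-(1 / 2) : ℝ) + b) : WeightedKernel s A := by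
  refine WeightedKernel.of_norm_le (κ := 1) (C := (a + b * R ^ (1 / 2 : ℝ)) * Real.exp R)
    hs one_pos hA fun x hx => ?_
  have hx0 : 0 < ‖x‖ := norm_pos_iff.2 hx
  have h6 : 0 < ‖x‖ ^ (-(1 / 2) : ℝ) := by positivity
  rcases le_or_gt R ‖x‖ with hR | hR
  · rw [h0 x hR, norm_zero]
    positivity
  · have h1 : 1 ≤ R ^ (1 / 2 : ℝ) * ‖x‖ ^ (-(1 / 2) : ℝ) := by
      rw [Real.rpow_neg hx0.le, ← div_eq_mul_inv, one_le_div (by positivity)]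
      gcongr
    have h2 : 1 ≤ Real.exp R * Real.exp (-(1 * ‖x‖)) := by
      rw [← Real.exp_add]; exact Real.one_le_exp (by linarith)
    calc ‖A x‖ ≤ a * ‖x‖ ^ (-(1 / 2) : ℝ) + b * 1 := by rw [mul_one]; exact h x hx hR
      _ ≤ a * ‖x‖ ^ (-(1 / 2) : ℝ) + b * (R ^ (1 / 2 : ℝ) * ‖x‖ ^ (-(1 / 2) : ℝ)) := by gcongr
      _ = (a + b * R ^ (1 / 2 : ℝ)) * ‖x‖ ^ (-(1 / 2) : ℝ) * 1 := by ring
      _ ≤ (a + b * R ^ (1 / 2 : ℝ)) * ‖x‖ ^ (-(1 / 2) : ℝ) *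
          (Real.exp R * Real.exp (-(1 * ‖x‖))) := by gcongr
      _ = _ := by ring

/-! ### The logarithmic potential -/

/-- The fundamental solution `-(2π)⁻¹ log |x|` of `-Δ`. -/
def logKernel (x : Plane) : ℂ := -(1 / (2 * (Real.pi : ℂ))) * (Real.log ‖x‖ : ℂ)

theorem measurable_logKernel : Measurable logKernel := by unfold logKernel; fun_prop

theorem freeKernel_sub_comm (z : ℂ) (x y : Plane) : freeKernel z (x - y) = freeKernel z (y - x) := by
  simp only [freeKernel, norm_sub_rev x]

theorem memWeightedL2_logKernel {s : ℝ} (hs : 1 < s) : MemWeightedL2 (-s) logKernel :=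
  (memWeightedL2_log hs).const_mul _

/-- Newton's theorem for the logarithmic potential of a radial kernel. -/
theorem conv_radial_logKernel {s : ℝ} (hs : 1 < s) {f : ℝ → ℂ} (hf : Measurable f)
    (hk : WeightedKernel s (fun x => f ‖x‖)) (x : Plane) :
    conv (fun x => f ‖x‖) logKernel x =
      -∫ r in Set.Ioi (0 : ℝ), (r : ℂ) * (Real.log (max ‖x‖ r) : ℂ) * f r := by
  have hs0 : 0 ≤ s := by linarith
  have e : ∀ y, logKernel (x - y) * f ‖y‖ =
      -(1 / (2 * (Real.pi : ℂ))) * (f ‖y‖ * (Real.log ‖x - y‖ : ℂ)) := by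
    intro y; rw [logKernel]; ring
  have hint : Integrable fun y : Plane => f ‖y‖ * (Real.log ‖x - y‖ : ℂ) := by
    have h1 := integrable_mul_of_weighted hk.memWeightedL2 ((memWeightedL2_log hs).translate hs0 x)
    simpa only [norm_sub_rev x] using h1
  rw [conv_comm, conv]
  simp only [e]
  rw [integral_const_mul, integral_radial_mul_log hf x hint]
  have hpi : (Real.pi : ℂ) ≠ 0 := by exact_mod_cast Real.pi_ne_zero
  field_simp

variable {z : ℂ}

/-- `(-Δ - z²) E = δ - z² E` for the logarithmic potential `E`, in resolvent form. -/
theorem conv_freeKernel_logKernel (hz : 0 < z.im) {x : Plane} (hx : x ≠ 0) :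
    -z ^ 2 * conv (freeKernel z) logKernel x = logKernel x - freeKernel z x := by
  have hm : Measurable fun r : ℝ => hankelKernel (z * r) :=
    measurable_hankelKernel.comp (by fun_prop)
  have h := conv_radial_logKernel (s := 2) one_lt_two hm (weightedKernel_freeKernel two_pos hz) x
  have h1 := neg_sq_mul_integral_log_max_hankelKernel hz (norm_pos_iff.2 hx)
  change conv (freeKernel z) logKernel x = _ at h
  rw [h, logKernel, freeKernel]
  linear_combination -h1

/-- The regularized value of the preceding identity at the origin. -/
theorem conv_freeKernel_logKernel_zero (hz : 0 < z.im) :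
    -z ^ 2 * conv (freeKernel z) logKernel 0 = -g z := by
  have hm : Measurable fun r : ℝ => hankelKernel (z * r) :=
    measurable_hankelKernel.comp (by fun_prop)
  have h := conv_radial_logKernel (s := 2) one_lt_two hm (weightedKernel_freeKernel two_pos hz) 0
  have h1 := neg_sq_mul_integral_log_hankelKernel hz
  change conv (freeKernel z) logKernel 0 = _ at h
  have e : ∀ r ∈ Set.Ioi (0 : ℝ), (r : ℂ) * (Real.log (max ‖(0 : Plane)‖ r) : ℂ) *
      hankelKernel (z * r) = (r : ℂ) * (Real.log r : ℂ) * hankelKernel (z * r) := by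
    intro r hr
    rw [norm_zero, max_eq_right (le_of_lt hr)]
  rw [setIntegral_congr_fun measurableSet_Ioi e] at h
  rw [h]
  linear_combination -h1

end

section

/-! ### A Liouville theorem for the free resolvent -/

/-- Radial profile of the cone-shaped probability density supported in the disc of radius `R`. -/
def tentProfile (R r : ℝ) : ℂ := ((3 / (Real.pi * R ^ 3) * max (R - r) 0 : ℝ) : ℂ)

/-- The cone-shaped probability density supported in the disc of radius `R`. -/
def tent (R : ℝ) (x : Plane) : ℂ := tentProfile R ‖x‖

theorem measurable_tentProfile (R : ℝ) : Measurable (tentProfile R) := by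
  unfold tentProfile; fun_prop

theorem measurable_tent (R : ℝ) : Measurable (tent R) :=
  (measurable_tentProfile R).comp measurable_norm

theorem tentProfile_eq_zero {R r : ℝ} (h : R ≤ r) : tentProfile R r = 0 := by
  rw [tentProfile, max_eq_right (by linarith)]; simp

theorem norm_tentProfile {R : ℝ} (hR : 0 < R) (r : ℝ) :
    ‖tentProfile R r‖ = 3 / (Real.pi * R ^ 3) * max (R - r) 0 := by
  have : 0 ≤ max (R - r) 0 := le_max_right _ _
  have := Real.pi_pos
  rw [tentProfile, Complex.norm_real, Real.norm_of_nonneg (by positivity)]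

variable {R : ℝ}

theorem weightedKernel_tent {s : ℝ} (hs : 0 < s) (hR : 0 < R) : WeightedKernel s (tent R) := by
  have hpi := Real.pi_pos
  refine WeightedKernel.of_norm_le_of_support (R := R) (a := 0)
    (b := 3 / (Real.pi * R ^ 3) * R) hs hR le_rfl (by positivity) (measurable_tent R)
    (fun x hx => tentProfile_eq_zero hx) fun x _ hx => ?_
  rw [tent, norm_tentProfile hR, zero_mul, zero_add]
  gcongr
  rw [max_eq_left (by linarith)]
  linarith [norm_nonneg x]

theorem integral_id_mul_norm_tentProfile (hR : 0 < R) :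
    IntegrableOn (fun r : ℝ => r * ‖tentProfile R r‖) (Set.Ioi 0) ∧
    ∫ r in Set.Ioi (0 : ℝ), r * ‖tentProfile R r‖ = 1 / (2 * Real.pi) := by
  have e : ∀ r ∈ Set.Ioi (0 : ℝ), r * ‖tentProfile R r‖ = (Set.Ioc 0 R).indicator
      (fun r => 3 / (Real.pi * R ^ 3) * (R * r - r ^ 2)) r := by
    intro r hr
    have hr : 0 < r := hr
    rw [norm_tentProfile hR]
    by_cases h : r ≤ R
    · rw [Set.indicator_of_mem (show r ∈ Set.Ioc 0 R from ⟨hr, h⟩), max_eq_left (by linarith)]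
      ring
    · rw [Set.indicator_of_notMem (fun h' => h h'.2), max_eq_right (by linarith)]
      ring
  have hc : Continuous fun r : ℝ => 3 / (Real.pi * R ^ 3) * (R * r - r ^ 2) := by fun_prop
  constructor
  · refine (integrableOn_congr_fun e measurableSet_Ioi).2 ?_
    exact ((integrable_indicator_iff measurableSet_Ioc).2
      (hc.integrableOn_Ioc (a := 0) (b := R))).integrableOn
  · rw [setIntegral_congr_fun measurableSet_Ioi e, setIntegral_indicator measurableSet_Ioc,
      Set.inter_eq_right.2 Set.Ioc_subset_Ioi_self, ← intervalIntegral.integral_of_le hR.le,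
      intervalIntegral.integral_const_mul, intervalIntegral.integral_sub
        ((by fun_prop : Continuous fun r : ℝ => R * r).intervalIntegrable _ _)
        ((by fun_prop : Continuous fun r : ℝ => r ^ 2).intervalIntegrable _ _),
      intervalIntegral.integral_const_mul, integral_id, integral_pow]
    have := Real.pi_pos
    push_cast
    field_simp
    ring

theorem id_mul_tentProfile (hR : 0 < R) (r : ℝ) :
    (r : ℂ) * tentProfile R r = ((r * ‖tentProfile R r‖ : ℝ) : ℂ) := by
  rw [norm_tentProfile hR, tentProfile, ← Complex.ofReal_mul]

/-- Outside its support a radial probability density has the potential of a point charge. -/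
theorem conv_tent_logKernel_of_le (hR : 0 < R) {x : Plane} (hx : R ≤ ‖x‖) :
    conv (tent R) logKernel x = logKernel x := by
  have h := conv_radial_logKernel (s := 2) one_lt_two (measurable_tentProfile R)
    (weightedKernel_tent two_pos hR) x
  have e : ∀ r ∈ Set.Ioi (0 : ℝ), (r : ℂ) * (Real.log (max ‖x‖ r) : ℂ) * tentProfile R r =
      (Real.log ‖x‖ : ℂ) * ((r * ‖tentProfile R r‖ : ℝ) : ℂ) := by
    intro r hr
    rw [← id_mul_tentProfile hR]
    rcases le_total r ‖x‖ with h1 | h1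
    · rw [max_eq_left h1]; ring
    · rw [tentProfile_eq_zero (hx.trans h1)]; ring
  change conv (tent R) logKernel x = _ at h
  rw [h, setIntegral_congr_fun measurableSet_Ioi e, integral_const_mul, integral_complex_ofReal,
    (integral_id_mul_norm_tentProfile hR).2, logKernel]
  push_cast
  ring

theorem norm_conv_tent_logKernel_le (hR : 0 < R) {x : Plane} (hx0 : 0 < ‖x‖) (hx : ‖x‖ < R) :
    ‖conv (tent R) logKernel x‖ ≤ (|Real.log ‖x‖| + |Real.log R|) * (1 / (2 * Real.pi)) := by
  have h := conv_radial_logKernel (s := 2) one_lt_two (measurable_tentProfile R)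
    (weightedKernel_tent two_pos hR) x
  change conv (tent R) logKernel x = _ at h
  obtain ⟨h1, h2⟩ := integral_id_mul_norm_tentProfile hR
  rw [h, norm_neg, ← h2, ← integral_const_mul]
  refine norm_integral_le_of_norm_le (h1.const_mul _) ?_
  filter_upwards [ae_restrict_mem measurableSet_Ioi] with r hr
  have hr : 0 < r := hr
  rcases le_or_gt R r with h3 | h3
  · simp [tentProfile_eq_zero h3]
  · rw [norm_mul, norm_mul, Complex.norm_real, Complex.norm_real, Real.norm_of_nonneg hr.le,
      Real.norm_eq_abs]
    have h4 : |Real.log (max ‖x‖ r)| ≤ |Real.log ‖x‖| + |Real.log R| := by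
      have h5 : Real.log ‖x‖ ≤ Real.log (max ‖x‖ r) := Real.log_le_log hx0 (le_max_left _ _)
      have h6 : Real.log (max ‖x‖ r) ≤ Real.log R :=
        Real.log_le_log (lt_max_of_lt_left hx0) (max_le hx.le h3.le)
      rw [abs_le]
      constructor
      · linarith [neg_abs_le (Real.log ‖x‖), abs_nonneg (Real.log R)]
      · linarith [le_abs_self (Real.log R), abs_nonneg (Real.log ‖x‖)]
    calc r * |Real.log (max ‖x‖ r)| * ‖tentProfile R r‖
        ≤ r * (|Real.log ‖x‖| + |Real.log R|) * ‖tentProfile R r‖ := by gcongr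
      _ = _ := by ring

/-- The potential `E - k_R * E` of a point charge screened by the density `k_R`; it vanishes outside
the disc of radius `R`. -/
def screened (R : ℝ) (x : Plane) : ℂ := logKernel x - conv (tent R) logKernel x

theorem weightedKernel_screened {s : ℝ} (hs : 0 < s) (hR : 0 < R) :
    WeightedKernel s (screened R) := by
  have hpi := Real.pi_pos
  refine WeightedKernel.of_norm_le_of_support (R := R) (a := 2 * (2 * (1 / (2 * Real.pi))))
    (b := 2 * (R * (1 / (2 * Real.pi))) + |Real.log R| * (1 / (2 * Real.pi))) hs hR
    (by positivity) (by positivity)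
    (measurable_logKernel.sub (measurable_conv (measurable_tent R) measurable_logKernel))
    (fun x hx => by rw [screened, conv_tent_logKernel_of_le hR hx, sub_self]) fun x hx0 hx => ?_
  have hx0 : 0 < ‖x‖ := norm_pos_iff.2 hx0
  have h1 : ‖logKernel x‖ = |Real.log ‖x‖| * (1 / (2 * Real.pi)) := by
    rw [logKernel, norm_mul, norm_neg, Complex.norm_real, Real.norm_eq_abs, mul_comm]
    congr 1
    simp [abs_of_pos hpi]
  have h2 := norm_conv_tent_logKernel_le hR hx0 hx
  have h3 := abs_log_le hx0
  have h4 : |Real.log ‖x‖| ≤ 2 * ‖x‖ ^ (-(1 / 2) : ℝ) + R := by linarith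
  have h5 := mul_le_mul_of_nonneg_right h4 (by positivity : 0 ≤ 1 / (2 * Real.pi))
  rw [screened]
  refine (norm_sub_le _ _).trans ?_
  rw [h1]
  linarith

variable {z : ℂ} {s : ℝ}

theorem conv_sub_right {A f h : Plane → ℂ} {x : Plane}
    (hf : Integrable fun y => A (x - y) * f y) (hh : Integrable fun y => A (x - y) * h y) :
    conv A (fun y => f y - h y) x = conv A f x - conv A h x := by
  simp only [conv, mul_sub]
  exact integral_sub hf hh

theorem conv_const_mul_right (A f : Plane → ℂ) (c : ℂ) (x : Plane) :
    conv A (fun y => c * f y) x = c * conv A f x := by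
  simp only [conv, mul_left_comm _ c]
  exact integral_const_mul _ _

/-- In the resolvent calculus, `screened R` solves `-Δ Φ = δ - k_R`. -/
theorem conv_tent_freeKernel_ae (hz : 0 < z.im) (hR : 0 < R) :
    conv (tent R) (freeKernel z) =ᵐ[volume] fun x =>
      freeKernel z x - screened R x - z ^ 2 * conv (freeKernel z) (screened R) x := by
  have hs : (0 : ℝ) ≤ 2 := zero_le_two
  have hG := weightedKernel_freeKernel (s := 2) two_pos hz
  have hk := weightedKernel_tent (s := 2) two_pos hR
  have hE := memWeightedL2_logKernel (s := 2) one_lt_two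
  have hkE := hk.memWeightedL2_conv hs hE
  have hGE := hG.memWeightedL2_conv hs hE
  have hG2 : MemWeightedL2 (-2) (freeKernel z) := hG.memWeightedL2.mono (by norm_num)
  have h1 : (fun x => z ^ 2 * conv (freeKernel z) logKernel x) =ᵐ[volume]
      fun x => freeKernel z x - logKernel x := by
    filter_upwards [ae_ne_zero] with x hx
    linear_combination -conv_freeKernel_logKernel hz hx
  filter_upwards [h1] with x hx
  have h2 : conv (freeKernel z) (screened R) x =
      conv (freeKernel z) logKernel x - conv (freeKernel z) (conv (tent R) logKernel) x :=
    conv_sub_right (hG.integrable_conv hs hE x) (hG.integrable_conv hs hkE x)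
  have h3 : conv (freeKernel z) (conv (tent R) logKernel) x =
      conv (tent R) (conv (freeKernel z) logKernel) x := by
    rw [hG.conv_conv hs hk hE, hk.conv_conv hs hG hE, funext (conv_comm (freeKernel z) (tent R))]
  have h4 : z ^ 2 * conv (tent R) (conv (freeKernel z) logKernel) x =
      conv (tent R) (freeKernel z) x - conv (tent R) logKernel x := by
    rw [← conv_const_mul_right, conv_congr_ae h1]
    exact conv_sub_right (hk.integrable_conv hs hG2 x) (hk.integrable_conv hs hE x)
  rw [h2, h3, screened]
  linear_combination hx - h4

theorem conv_congr_ae_left {A B f : Plane → ℂ} (h : A =ᵐ[volume] B) (x : Plane) :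
    conv A f x = conv B f x := by
  rw [conv_comm A, conv_comm B, conv_congr_ae h]

/-- Mean value property: a fixed point of `-z² G_z *` is reproduced by averages over discs. -/
theorem conv_tent_ae_eq (hs : 0 < s) (hz : 0 < z.im) (hR : 0 < R) {w : Plane → ℂ}
    (hw : MemWeightedL2 (-s) w)
    (h : w =ᵐ[volume] fun x => -z ^ 2 * conv (freeKernel z) w x) :
    conv (tent R) w =ᵐ[volume] w := by
  have hG := weightedKernel_freeKernel hs hz
  have hk := weightedKernel_tent hs hR
  have hΦ := weightedKernel_screened hs hR
  have hz0 : z ≠ 0 := by rintro rfl; simp at hz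
  have h1 : conv (freeKernel z) w =ᵐ[volume] fun x => -(z ^ 2)⁻¹ * w x := by
    filter_upwards [h] with x hx
    rw [hx]
    field_simp
  filter_upwards [h1] with x hx
  have e1 : conv (tent R) (conv (freeKernel z) w) x = -(z ^ 2)⁻¹ * conv (tent R) w x := by
    rw [conv_congr_ae h1, conv_const_mul_right]
  have e2 : conv (screened R) (conv (freeKernel z) w) x = -(z ^ 2)⁻¹ * conv (screened R) w x := by
    rw [conv_congr_ae h1, conv_const_mul_right]
  have e3 : conv (conv (freeKernel z) (screened R)) w x =
      conv (screened R) (conv (freeKernel z) w) x := by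
    rw [hΦ.conv_conv hs.le hG hw, funext (conv_comm (freeKernel z) (screened R))]
  have i1 := hG.integrable_conv hs.le hw x
  have i2 := hΦ.integrable_conv hs.le hw x
  have i3 := hG.integrable_conv_conv hs.le hΦ hw x
  have e4 : conv (tent R) (conv (freeKernel z) w) x =
      conv (freeKernel z) w x - conv (screened R) w x -
        z ^ 2 * conv (conv (freeKernel z) (screened R)) w x := by
    rw [hk.conv_conv hs.le hG hw, conv_congr_ae_left (conv_tent_freeKernel_ae hz hR)]
    rw [conv]
    simp only [sub_mul, mul_assoc (z ^ 2)]
    have := integral_sub (i1.sub i2) (i3.const_mul (z ^ 2))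
    simp only [Pi.sub_apply] at this
    rw [this, integral_const_mul, integral_sub i1 i2]
    rfl
  rw [e1, e3, e2, hx] at e4
  have hz2 : z ^ 2 ≠ 0 := pow_ne_zero 2 hz0
  field_simp at e4
  linear_combination -e4

theorem norm_tent_sub_tent_le {R : ℝ} (hR : 0 < R) (x y : Plane) :
    ‖tent R x - tent R y‖ ≤ 3 / (Real.pi * R ^ 3) * ‖x - y‖ := by
  have hpi := Real.pi_pos
  rw [tent, tent, tentProfile, tentProfile, ← Complex.ofReal_sub, Complex.norm_real, ← mul_sub,
    norm_mul, Real.norm_of_nonneg (by positivity), Real.norm_eq_abs]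
  gcongr
  refine (abs_max_sub_max_le_abs _ _ _).trans ?_
  rw [sub_sub_sub_cancel_left, abs_sub_comm]
  exact abs_norm_sub_norm_le x y

theorem tent_sub_eq_zero {R : ℝ} {x y : Plane} (hx : ‖x‖ ≤ R) (hy : 2 * R < ‖y‖) :
    tent R (x - y) = 0 := by
  refine tentProfile_eq_zero ?_
  have := norm_sub_norm_le y x
  rw [norm_sub_rev] at this
  linarith

/-- Averages over the disc of radius `R` of a function in `L²_{-s}` oscillate by `O(R^{s-2})`. -/
theorem norm_conv_tent_sub_le (hs : 0 < s) {w : Plane → ℂ} (hw : MemWeightedL2 (-s) w) {R : ℝ}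
    (hR : 1 ≤ R) {x x' : Plane} (hx : ‖x‖ ≤ R) (hx' : ‖x'‖ ≤ R) :
    ‖conv (tent R) w x - conv (tent R) w x'‖ ≤ 3 / Real.pi * ‖x - x'‖ * 3 ^ s *
      (2 * Real.pi + ∫ y, ‖weighted (-s) w y‖ ^ 2) * R ^ (s - 2) := by
  have hR0 : 0 < R := by linarith
  have hpi := Real.pi_pos
  have hk := weightedKernel_tent hs hR0
  have hv : Integrable fun y => ‖weighted (-s) w y‖ ^ 2 :=
    (memLp_two_iff_integrable_sq_norm hw.1).1 hw
  set c : ℝ := 3 / (Real.pi * R ^ 3) * ‖x - x'‖ * (3 * R) ^ s / 2 with hc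
  set D : Set Plane := Metric.closedBall 0 (2 * R) with hD
  have hDi : Integrable (D.indicator fun _ : Plane => R⁻¹) :=
    (integrable_indicator_iff Metric.isClosed_closedBall.measurableSet).2
      (integrableOn_const (measure_closedBall_lt_top.ne))
  have key : ∀ y, ‖tent R (x - y) * w y - tent R (x' - y) * w y‖ ≤
      c * (D.indicator (fun _ => R⁻¹) y + R * ‖weighted (-s) w y‖ ^ 2) := by
    intro y
    by_cases hy : y ∈ D
    -- On the disc, `|v| ≤ (R⁻¹ + R |v|²) / 2` replaces the Cauchy–Schwarz inequality.
    · have hy' : ‖y‖ ≤ 2 * R := by simpa [hD] using hy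
      rw [Set.indicator_of_mem hy, ← sub_mul, norm_mul]
      have h1 : ‖tent R (x - y) - tent R (x' - y)‖ ≤ 3 / (Real.pi * R ^ 3) * ‖x - x'‖ := by
        simpa using norm_tent_sub_tent_le hR0 (x - y) (x' - y)
      have hb := bracket_pos y
      have h2 : ‖w y‖ = bracket y ^ s * ‖weighted (-s) w y‖ := by
        rw [norm_weighted, ← mul_assoc, ← Real.rpow_add hb]; simp
      have h3 : bracket y ^ s ≤ (3 * R) ^ s := by
        refine Real.rpow_le_rpow hb.le ?_ hs.le
        linarith [bracket_le y]
      have h4 : ‖weighted (-s) w y‖ ≤ (R⁻¹ + R * ‖weighted (-s) w y‖ ^ 2) / 2 := by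
        have h5 : 0 ≤ R⁻¹ * (1 - R * ‖weighted (-s) w y‖) ^ 2 := by positivity
        have h6 : R⁻¹ * (1 - R * ‖weighted (-s) w y‖) ^ 2 =
            R⁻¹ - 2 * ‖weighted (-s) w y‖ + R * ‖weighted (-s) w y‖ ^ 2 := by
          field_simp; ring
        linarith
      rw [h2]
      calc _ ≤ (3 / (Real.pi * R ^ 3) * ‖x - x'‖) * ((3 * R) ^ s *
            ((R⁻¹ + R * ‖weighted (-s) w y‖ ^ 2) / 2)) := by gcongr
        _ = _ := by rw [hc]; ring
    · have hy' : 2 * R < ‖y‖ := by simpa [hD] using hy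
      rw [tent_sub_eq_zero hx hy', tent_sub_eq_zero hx' hy', zero_mul, sub_zero, norm_zero,
        Set.indicator_of_notMem hy]
      positivity
  have hint : ∫ y, c * (D.indicator (fun _ => R⁻¹) y + R * ‖weighted (-s) w y‖ ^ 2) =
      c * (4 * Real.pi * R + R * ∫ y, ‖weighted (-s) w y‖ ^ 2) := by
    rw [integral_const_mul, integral_add hDi (hv.const_mul R), integral_const_mul,
      integral_indicator Metric.isClosed_closedBall.measurableSet, setIntegral_const,
      Measure.real, EuclideanSpace.volume_closedBall_fin_two, ENNReal.toReal_mul,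
      ENNReal.toReal_pow, ENNReal.toReal_ofReal (by positivity), ENNReal.toReal_ofReal hpi.le,
      smul_eq_mul]
    congr 2
    field_simp
    ring
  have hb := norm_integral_le_of_norm_le ((hDi.add (hv.const_mul R)).const_mul c)
    (Eventually.of_forall key)
  simp only [Pi.add_apply] at hb
  rw [integral_sub (hk.integrable_conv hs.le hw x) (hk.integrable_conv hs.le hw x'), hint] at hb
  refine hb.trans ?_
  have hRs : R ^ (s - 2) * R ^ 2 = R ^ s := by
    rw [← Real.rpow_natCast R 2, ← Real.rpow_add hR0]; congr 1; push_cast; ring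
  have hi : 0 ≤ ∫ y, ‖weighted (-s) w y‖ ^ 2 := integral_nonneg fun y => by positivity
  have e : c = 3 / Real.pi * ‖x - x'‖ * 3 ^ s * R ^ (s - 2) / R / 2 := by
    rw [hc, Real.mul_rpow (by norm_num) hR0.le, ← hRs]
    field_simp
  rw [e]
  have e2 : 3 / Real.pi * ‖x - x'‖ * 3 ^ s * R ^ (s - 2) / R / 2 *
      (4 * Real.pi * R + R * ∫ y, ‖weighted (-s) w y‖ ^ 2) =
      3 / Real.pi * ‖x - x'‖ * 3 ^ s * (2 * Real.pi + (∫ y, ‖weighted (-s) w y‖ ^ 2) / 2) *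
        R ^ (s - 2) := by
    field_simp
    ring
  rw [e2]
  gcongr
  linarith

/-- Liouville's theorem: for `s < 2` the only fixed points of `-z² G_z *` in `L²_{-s}` are the
constants. -/
theorem exists_const_of_fixed (hs : 0 < s) (hs2 : s < 2) (hz : 0 < z.im) {w : Plane → ℂ}
    (hw : MemWeightedL2 (-s) w)
    (h : w =ᵐ[volume] fun x => -z ^ 2 * conv (freeKernel z) w x) :
    ∃ c : ℂ, w =ᵐ[volume] fun _ => c := by
  have h1 : ∀ᵐ x : Plane, ∀ n : ℕ, conv (tent ((n : ℝ) + 1)) w x = w x :=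
    ae_all_iff.2 fun n => conv_tent_ae_eq hs hz (by positivity) hw h
  obtain ⟨x₀, hx₀⟩ := h1.exists
  refine ⟨w x₀, ?_⟩
  filter_upwards [h1] with x hx
  have hlim : Tendsto (fun n : ℕ => 3 / Real.pi * ‖x - x₀‖ * 3 ^ s *
      (2 * Real.pi + ∫ y, ‖weighted (-s) w y‖ ^ 2) * ((n : ℝ) + 1) ^ (s - 2)) atTop (𝓝 0) := by
    have h2 : Tendsto (fun n : ℕ => (n : ℝ) + 1) atTop atTop :=
      tendsto_atTop_add_const_right _ _ tendsto_natCast_atTop_atTop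
    have h3 := (tendsto_rpow_neg_atTop (by linarith : 0 < 2 - s)).comp h2
    simpa [Function.comp_def] using h3.const_mul (3 / Real.pi * ‖x - x₀‖ * 3 ^ s *
      (2 * Real.pi + ∫ y, ‖weighted (-s) w y‖ ^ 2))
  have hle : ‖w x - w x₀‖ ≤ 0 := by
    refine ge_of_tendsto hlim ?_
    filter_upwards [eventually_ge_atTop (Nat.ceil (max ‖x‖ ‖x₀‖))] with n hn
    have hn' : max ‖x‖ ‖x₀‖ ≤ n := (Nat.le_ceil _).trans (by exact_mod_cast hn)
    have h4 := norm_conv_tent_sub_le hs hw (R := (n : ℝ) + 1) (by simp) (x := x) (x' := x₀)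
      (by linarith [le_max_left ‖x‖ ‖x₀‖]) (by linarith [le_max_right ‖x‖ ‖x₀‖])
    rwa [hx n, hx₀ n] at h4
  exact sub_eq_zero.1 (norm_le_zero_iff.1 hle)

end

section

variable {z : ℂ} {s : ℝ} {N : ℕ}

/-! ### The extended resolvent -/

theorem integral_freeKernel_sub_mul (z : ℂ) (f : Plane → ℂ) (a : Plane) :
    ∫ y, freeKernel z (y - a) * f y = conv (freeKernel z) f a := by
  simp only [conv, freeKernel_sub_comm z a]

theorem resolventFun_eq (α : Fin N → ℝ) (Y : Fin N → Plane) (z : ℂ) (f : Plane → ℂ) (x : Plane) :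
    resolventFun α Y z f x = conv (freeKernel z) f x +
      ∑ j, ((Gam α Y z)⁻¹.mulVec fun k => conv (freeKernel z) f (Y k)) j *
        freeKernel z (x - Y j) := by
  simp only [resolventFun, integral_freeKernel_sub_mul, Matrix.mulVec, dotProduct, Finset.sum_mul]
  congr 1
  refine Finset.sum_congr rfl fun j _ => Finset.sum_congr rfl fun k _ => ?_
  ring

theorem resolventFun_sub (hs : 0 < s) (hz : 0 < z.im) (α : Fin N → ℝ) (Y : Fin N → Plane)
    {f h : Plane → ℂ} (hf : MemWeightedL2 (-s) f) (hh : MemWeightedL2 (-s) h) (x : Plane) :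
    resolventFun α Y z (fun y => f y - h y) x =
      resolventFun α Y z f x - resolventFun α Y z h x := by
  have hG := weightedKernel_freeKernel hs hz
  have e : ∀ x, conv (freeKernel z) (fun y => f y - h y) x =
      conv (freeKernel z) f x - conv (freeKernel z) h x := fun x =>
    conv_sub_right (hG.integrable_conv hs.le hf x) (hG.integrable_conv hs.le hh x)
  simp only [resolventFun_eq, e]
  have e2 : (fun k => conv (freeKernel z) f (Y k) - conv (freeKernel z) h (Y k)) =
      (fun k => conv (freeKernel z) f (Y k)) - fun k => conv (freeKernel z) h (Y k) := rfl
  rw [e2, Matrix.mulVec_sub]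
  simp only [Pi.sub_apply, sub_mul, Finset.sum_sub_distrib]
  ring

theorem resolventFun_congr_ae (α : Fin N → ℝ) (Y : Fin N → Plane) (z : ℂ) {f h : Plane → ℂ}
    (hfh : f =ᵐ[volume] h) (x : Plane) : resolventFun α Y z f x = resolventFun α Y z h x := by
  simp only [resolventFun_eq, conv_congr_ae hfh]

theorem enorm_conv_le {A f : Plane → ℂ} (hA : AEStronglyMeasurable A)
    (hf : AEStronglyMeasurable f) (x : Plane) :
    ‖conv A f x‖ₑ ≤ weightedNorm s (fun y => A (x - y)) * weightedNorm (-s) f := by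
  have hAx : AEStronglyMeasurable (fun y => A (x - y)) :=
    hA.comp_measurePreserving (Measure.measurePreserving_sub_left volume x)
  have h := eLpNorm_smul_le_mul_eLpNorm (p := 2) (q := 2) (r := 1)
    (aestronglyMeasurable_weighted (s := -s) hf) (aestronglyMeasurable_weighted (s := s) hAx)
  refine le_trans ?_ h
  rw [conv, eLpNorm_one_eq_lintegral_enorm]
  refine (enorm_integral_le_lintegral_enorm _).trans_eq ?_
  congr 1; ext y
  have := bracket_pos y
  congr 1
  simp only [Pi.smul_apply', smul_eq_mul, weighted_apply]
  rw [mul_mul_mul_comm, ← Complex.ofReal_mul, ← Real.rpow_add this]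
  simp

theorem memWeightedL2_freeKernel_sub (hs : 0 < s) (hz : 0 < z.im) (a : Plane) :
    MemWeightedL2 (-s) (fun x => freeKernel z (x - a)) :=
  ((weightedKernel_freeKernel hs hz).memWeightedL2.mono (by linarith : -s ≤ s)).translate hs.le a

theorem memWeightedL2_resolventFun (hs : 0 < s) (hz : 0 < z.im) (α : Fin N → ℝ)
    (Y : Fin N → Plane) {f : Plane → ℂ} (hf : MemWeightedL2 (-s) f) :
    MemWeightedL2 (-s) (resolventFun α Y z f) := by
  rw [funext (resolventFun_eq α Y z f)]
  exact ((weightedKernel_freeKernel hs hz).memWeightedL2_conv hs.le hf).add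
    (MemWeightedL2.sum _ fun j _ => (memWeightedL2_freeKernel_sub hs hz (Y j)).const_mul _)

theorem weightedNorm_add_le {u v : Plane → ℂ} (hu : AEStronglyMeasurable u)
    (hv : AEStronglyMeasurable v) :
    weightedNorm s (fun x => u x + v x) ≤ weightedNorm s u + weightedNorm s v := by
  rw [weightedNorm, weighted_add]
  exact eLpNorm_add_le (aestronglyMeasurable_weighted hu) (aestronglyMeasurable_weighted hv)
    one_le_two

theorem weightedNorm_const_mul (c : ℂ) (u : Plane → ℂ) :
    weightedNorm s (fun x => c * u x) = ‖c‖ₑ * weightedNorm s u := by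
  rw [weightedNorm, weighted_const_mul]
  exact eLpNorm_const_smul c (weighted s u) 2 volume

theorem weightedNorm_sum_le {ι : Type*} (t : Finset ι) {u : ι → Plane → ℂ}
    (hu : ∀ i ∈ t, AEStronglyMeasurable (u i)) :
    weightedNorm s (fun x => ∑ i ∈ t, u i x) ≤ ∑ i ∈ t, weightedNorm s (u i) := by
  have e : weighted s (fun x => ∑ i ∈ t, u i x) = ∑ i ∈ t, weighted s (u i) := by
    ext x; simp only [weighted_apply, Finset.sum_apply, Finset.mul_sum]
  rw [weightedNorm, e]
  exact eLpNorm_sum_le (fun i hi => aestronglyMeasurable_weighted (hu i hi)) one_le_two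

/-- `R(z²)` is bounded on `L²_{-s}`. -/
theorem weightedNorm_resolventFun_le (hs : 0 < s) (hz : 0 < z.im) (α : Fin N → ℝ)
    (Y : Fin N → Plane) : ∃ C : ENNReal, C ≠ ⊤ ∧ ∀ f : Plane → ℂ, AEStronglyMeasurable f →
      weightedNorm (-s) (resolventFun α Y z f) ≤ C * weightedNorm (-s) f := by
  have hG := weightedKernel_freeKernel hs hz
  obtain ⟨C₀, hC₀, h₀⟩ := hG.weightedNorm_conv_le hs.le
  refine ⟨C₀ + ∑ j, (∑ k, ‖(Gam α Y z)⁻¹ j k‖ₑ *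
    weightedNorm s (fun y => freeKernel z (Y k - y))) *
      weightedNorm (-s) (fun x => freeKernel z (x - Y j)), ?_, fun f hf => ?_⟩
  · refine ENNReal.add_ne_top.2 ⟨hC₀, ENNReal.sum_ne_top.2 fun j _ => ENNReal.mul_ne_top
      (ENNReal.sum_ne_top.2 fun k _ => ENNReal.mul_ne_top enorm_ne_top ?_) ?_⟩
    · exact (hG.memLp_translate hs.le (Y k)).2.ne
    · exact (memWeightedL2_freeKernel_sub hs hz (Y j)).2.ne
  · have hm : ∀ j, AEStronglyMeasurable (fun x => freeKernel z (x - Y j)) := fun j =>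
      (memWeightedL2_freeKernel_sub hs hz (Y j)).aestronglyMeasurable
    rw [funext (resolventFun_eq α Y z f)]
    refine (weightedNorm_add_le (aestronglyMeasurable_conv hG.measurable hf)
      (Finset.aestronglyMeasurable_fun_sum _ fun j _ => (hm j).const_mul _)).trans ?_
    rw [add_mul, Finset.sum_mul]
    refine add_le_add (h₀ f hf) ((weightedNorm_sum_le _ fun j _ => (hm j).const_mul _).trans ?_)
    refine Finset.sum_le_sum fun j _ => ?_
    rw [weightedNorm_const_mul, mul_right_comm]
    gcongr
    rw [Matrix.mulVec, dotProduct, Finset.sum_mul]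
    refine (enorm_sum_le _ _).trans (Finset.sum_le_sum fun k _ => ?_)
    rw [enorm_mul, mul_assoc]
    gcongr
    exact enorm_conv_le hG.measurable.aestronglyMeasurable hf _

/-- Compactly supported functions are dense, so `L²` is dense in `L²_{-s}`. -/
theorem exists_memLp_weightedNorm_sub_le {f : Plane → ℂ} (hf : MemWeightedL2 (-s) f) {ε : ENNReal}
    (hε : ε ≠ 0) : ∃ h : Plane → ℂ, MemLp h 2 volume ∧
      weightedNorm (-s) (fun x => h x - f x) ≤ ε := by
  obtain ⟨k, hk, hle, hkc, hk2⟩ := MemLp.exists_hasCompactSupport_eLpNorm_sub_le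
    (by norm_num) hf hε
  refine ⟨weighted s k, ?_, ?_⟩
  · have hc : Continuous (weighted s k) := by
      have h1 : Continuous fun x : Plane => ((bracket x ^ s : ℝ) : ℂ) :=
        Complex.continuous_ofReal.comp
          (continuous_bracket.rpow_const fun x => Or.inl (bracket_pos x).ne')
      exact h1.mul hkc
    exact hc.memLp_of_hasCompactSupport hk.mul_left
  · have e : weighted (-s) (fun x => weighted s k x - f x) = -(weighted (-s) f - k) := by
      ext x
      have := congrFun (weighted_weighted_neg s k) x
      rw [weighted_apply] at this ⊢
      rw [mul_sub, this, Pi.neg_apply, Pi.sub_apply, weighted_apply (-s) f]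
      ring
    rw [weightedNorm, e, eLpNorm_neg]
    exact hle

/-- The extension by continuity is given by the same formula. -/
theorem extendedResolvent_iff (hs : 0 < s) (hz : 0 < z.im) (α : Fin N → ℝ) (Y : Fin N → Plane)
    (f u : Fn) : ExtendedResolvent α Y s z f u ↔
      MemWeightedL2 (-s) f ∧ MemWeightedL2 (-s) u ∧ u =ᵐ[volume] resolventFun α Y z f := by
  obtain ⟨C, hC, hbd⟩ := weightedNorm_resolventFun_le hs hz α Y
  have hsub : ∀ h : Plane → ℂ, MemWeightedL2 (-s) h → MemWeightedL2 (-s) f →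
      weightedNorm (-s) (fun x => resolventFun α Y z h x - resolventFun α Y z f x) ≤
        C * weightedNorm (-s) (fun x => h x - f x) := by
    intro h hh hf
    rw [← funext fun x => resolventFun_sub hs hz α Y hh hf x]
    exact hbd _ (hh.sub hf).aestronglyMeasurable
  refine and_congr_right fun hf => and_congr_right fun hu => ⟨?_, ?_⟩
  · rintro ⟨fn, hfn, h1, h2⟩
    have hRf := memWeightedL2_resolventFun hs hz α Y hf
    have h3 : ∀ n, weightedNorm (-s) (fun x => u x - resolventFun α Y z f x) ≤
        weightedNorm (-s) (fun x => resolventFun α Y z (fn n) x - u x) +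
          C * weightedNorm (-s) (fun x => fn n x - f x) := by
      intro n
      have hn : MemWeightedL2 (-s) (fn n) := MemLp.memWeightedL2_neg hs.le (hfn n)
      have hRn := memWeightedL2_resolventFun hs hz α Y hn
      refine le_trans ?_ (add_le_add_right (hsub _ hn hf) _)
      have e : (fun x => u x - resolventFun α Y z f x) = fun x =>
          (-1) * (resolventFun α Y z (fn n) x - u x) +
            (resolventFun α Y z (fn n) x - resolventFun α Y z f x) := by ext x; ring
      rw [e]
      refine (weightedNorm_add_le (((hRn.sub hu).const_mul (-1)).aestronglyMeasurable)
        (hRn.sub hRf).aestronglyMeasurable).trans ?_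
      rw [weightedNorm_const_mul]
      simp
    have h4 : weightedNorm (-s) (fun x => u x - resolventFun α Y z f x) = 0 := by
      have h5 : Tendsto (fun n => weightedNorm (-s) (fun x => resolventFun α Y z (fn n) x - u x) +
          C * weightedNorm (-s) (fun x => fn n x - f x)) atTop (𝓝 0) := by
        simpa using h2.add (ENNReal.Tendsto.const_mul h1 (Or.inr hC))
      exact le_antisymm (ge_of_tendsto' h5 h3) zero_le
    rw [weightedNorm, eLpNorm_eq_zero_iff (hu.sub hRf).1 two_ne_zero] at h4
    filter_upwards [h4] with x hx
    have hb := bracket_pos x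
    rw [weighted_apply, Pi.zero_apply, mul_eq_zero] at hx
    rcases hx with hx | hx
    · exact absurd hx (by exact_mod_cast (Real.rpow_pos_of_pos hb _).ne')
    · exact sub_eq_zero.1 hx
  · intro hae
    have hex : ∀ n : ℕ, ∃ h : Plane → ℂ, MemLp h 2 volume ∧
        weightedNorm (-s) (fun x => h x - f x) ≤ ((n : ENNReal) + 1)⁻¹ := fun n =>
      exists_memLp_weightedNorm_sub_le hf (ENNReal.inv_ne_zero.2 (by finiteness))
    choose fn hfn hle using hex
    have hlim : Tendsto (fun n => weightedNorm (-s) (fun x => fn n x - f x)) atTop (𝓝 0) := by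
      refine tendsto_of_tendsto_of_tendsto_of_le_of_le tendsto_const_nhds ?_
        (fun n => zero_le) hle
      have := (tendsto_add_atTop_iff_nat 1).2 ENNReal.tendsto_inv_nat_nhds_zero
      simpa using this
    refine ⟨fn, hfn, hlim, ?_⟩
    have h5 : Tendsto (fun n => C * weightedNorm (-s) (fun x => fn n x - f x)) atTop (𝓝 0) := by
      simpa using ENNReal.Tendsto.const_mul hlim (Or.inr hC)
    refine tendsto_of_tendsto_of_tendsto_of_le_of_le tendsto_const_nhds h5
      (fun n => zero_le) fun n => ?_
    refine le_trans (le_of_eq ?_) (hsub _ (MemLp.memWeightedL2_neg hs.le (hfn n)) hf)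
    refine eLpNorm_congr_ae ?_
    filter_upwards [hae] with x hx
    simp only [weighted_apply, hx]

/-! ### The null space -/

theorem conv_translate (A f : Plane → ℂ) (a x : Plane) :
    conv A (fun y => f (y - a)) x = conv A f (x - a) := by
  rw [conv, ← integral_add_right_eq_self _ a, conv]
  simp only [add_sub_cancel_right, sub_add_eq_sub_sub_swap]

/-- The potential `c + ∑_j a_j E(x - y_j)`. -/
def potential (Y : Fin N → Plane) (c : ℂ) (a : Fin N → ℂ) (x : Plane) : ℂ :=
  c + ∑ j, a j * logKernel (x - Y j)

theorem memWeightedL2_sum_logKernel (hs : 1 < s) (Y : Fin N → Plane) (a : Fin N → ℂ) :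
    MemWeightedL2 (-s) (fun x => ∑ j, a j * logKernel (x - Y j)) :=
  MemWeightedL2.sum _ fun j _ =>
    ((memWeightedL2_logKernel hs).translate (by linarith) (Y j)).const_mul _

theorem memWeightedL2_potential (hs : 1 < s) (Y : Fin N → Plane) (c : ℂ) (a : Fin N → ℂ) :
    MemWeightedL2 (-s) (potential Y c a) :=
  (memWeightedL2_const hs c).add (memWeightedL2_sum_logKernel hs Y a)

theorem conv_freeKernel_sum_logKernel (z : ℂ) (hz : 0 < z.im) (Y : Fin N → Plane) (a : Fin N → ℂ)
    (x : Plane) : -z ^ 2 * conv (freeKernel z) (fun x => ∑ j, a j * logKernel (x - Y j)) x =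
      ∑ j, a j * (-z ^ 2 * conv (freeKernel z) logKernel (x - Y j)) := by
  have hG := weightedKernel_freeKernel (s := 2) two_pos hz
  have hE := memWeightedL2_logKernel (s := 2) one_lt_two
  have hi : ∀ j, Integrable fun y => freeKernel z (x - y) * (a j * logKernel (y - Y j)) := fun j =>
    hG.integrable_conv zero_le_two ((hE.translate zero_le_two (Y j)).const_mul (a j)) x
  rw [conv]
  simp only [Finset.mul_sum]
  rw [integral_finsetSum _ fun j _ => hi j, Finset.mul_sum]
  refine Finset.sum_congr rfl fun j _ => ?_
  have := conv_const_mul_right (freeKernel z) (fun y => logKernel (y - Y j)) (a j) x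
  rw [conv_translate] at this
  rw [mul_left_comm, ← this, conv]

theorem conv_freeKernel_potential (hz : 0 < z.im) (Y : Fin N → Plane) (c : ℂ) (a : Fin N → ℂ)
    (x : Plane) : -z ^ 2 * conv (freeKernel z) (potential Y c a) x =
      c + ∑ j, a j * (-z ^ 2 * conv (freeKernel z) logKernel (x - Y j)) := by
  have hG := weightedKernel_freeKernel (s := 2) two_pos hz
  rw [← conv_freeKernel_sum_logKernel z hz]
  have h1 := hG.integrable_conv zero_le_two (memWeightedL2_const one_lt_two c) x
  have h2 := hG.integrable_conv zero_le_two (memWeightedL2_sum_logKernel one_lt_two Y a) x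
  have h3 : ∫ y, freeKernel z (x - y) * c = (∫ y, freeKernel z y) * c := by
    rw [integral_mul_const, integral_sub_left_eq_self (freeKernel z) volume x]
  have h4 := integral_freeKernel hz
  simp only [conv, potential, mul_add] at h1 h2 ⊢
  rw [integral_add h1 h2, h3]
  linear_combination c * h4

theorem ae_sub_ne_zero (Y : Fin N → Plane) : ∀ᵐ x : Plane, ∀ j, x - Y j ≠ 0 := by
  refine ae_all_iff.2 fun j => ?_
  simp [ae_iff, sub_eq_zero]

/-- At the sites `-z² G * E` produces the entries of `Γ(z) - D̃`; the diagonal is the regularized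
value `-g z`. -/
theorem conv_freeKernel_logKernel_site (hz : 0 < z.im) (α : Fin N → ℝ) {Y : Fin N → Plane}
    (hY : Function.Injective Y) (k j : Fin N) :
    -z ^ 2 * conv (freeKernel z) logKernel (Y k - Y j) = Gam α Y z k j - Dt α Y k j := by
  by_cases h : k = j
  · subst h
    rw [sub_self, conv_freeKernel_logKernel_zero hz]
    simp [Gam, Dt]
  · rw [conv_freeKernel_logKernel hz (sub_ne_zero.2 fun h' => h (hY h'))]
    simp only [Gam, Dt, Matrix.of_apply, if_neg h, logKernel]
    push_cast
    ring

/-- The values of `-z² G_z * (c + ∑_j a_j E(· - y_j))` at the sites. -/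
theorem conv_freeKernel_potential_site (hz : 0 < z.im) (α : Fin N → ℝ) {Y : Fin N → Plane}
    (hY : Function.Injective Y) (c : ℂ) (a : Fin N → ℂ) (k : Fin N) :
    -z ^ 2 * conv (freeKernel z) (potential Y c a) (Y k) =
      c + (Gam α Y z).mulVec a k - (Dt α Y).mulVec a k := by
  rw [conv_freeKernel_potential hz]
  simp only [conv_freeKernel_logKernel_site hz α hY, Matrix.mulVec, dotProduct, add_sub_assoc,
    ← Finset.sum_sub_distrib]
  congr 1
  exact Finset.sum_congr rfl fun j _ => by ring

theorem resolventFun_neg_sq_mul (α : Fin N → ℝ) (Y : Fin N → Plane) (z : ℂ) (u : Plane → ℂ)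
    (x : Plane) : resolventFun α Y z (fun y => -z ^ 2 * u y) x =
      -z ^ 2 * conv (freeKernel z) u x +
        ∑ j, ((Gam α Y z)⁻¹.mulVec fun k => -z ^ 2 * conv (freeKernel z) u (Y k)) j *
          freeKernel z (x - Y j) := by
  simp only [resolventFun_eq, conv_const_mul_right]

theorem projection_mulVec (v : Fin N → ℂ) (k : Fin N) :
    (P N).mulVec v k = (∑ j, v j) / (N : ℂ) := by
  have h : (((Real.sqrt N)⁻¹ : ℝ) : ℂ) * (((Real.sqrt N)⁻¹ : ℝ) : ℂ) = (N : ℂ)⁻¹ := by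
    rw [← Complex.ofReal_mul, ← mul_inv, Real.mul_self_sqrt (Nat.cast_nonneg N)]
    push_cast; rfl
  simp only [P, Matrix.mulVec, dotProduct, Matrix.vecMulVec_apply, h, ← Finset.mul_sum]
  rw [div_eq_inv_mul]

/-- `S D̃ a = 0` says that all entries of `D̃ a` agree with their mean. -/
theorem complement_mulVec_eq_zero_iff (D : Matrix (Fin N) (Fin N) ℂ) (a : Fin N → ℂ) :
    (S N * D).mulVec a = 0 ↔ ∀ k, D.mulVec a k = (∑ j, D.mulVec a j) / (N : ℂ) := by
  rw [← Matrix.mulVec_mulVec, S, Matrix.sub_mulVec, Matrix.one_mulVec, sub_eq_zero, funext_iff]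
  simp only [projection_mulVec]

theorem phiFun_eq_potential (α : Fin N → ℝ) (Y : Fin N → Plane) (a : Fin N → ℂ) :
    phiFun α Y a = potential Y ((∑ j, (Dt α Y).mulVec a j) / (N : ℂ)) a := by
  ext x
  simp only [phiFun, potential, logKernel, sub_eq_add_neg, Finset.mul_sum, ← Finset.sum_neg_distrib]
  congr 1
  exact Finset.sum_congr rfl fun j _ => by ring

/-- A null vector is a solution in `L²_{-s}` of `u = R(z²) (-z² u)`. -/
theorem mem_nullSpace_iff (hs : 1 < s) (hz : 0 < z.im) (α : Fin N → ℝ) (Y : Fin N → Plane)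
    (u : Fn) : u ∈ nullSpace α Y s z ↔ MemWeightedL2 (-s) u ∧
      u =ᵐ[volume] resolventFun α Y z (fun y => -z ^ 2 * u y) := by
  have e : ((0 - z ^ 2 • u : Fn) : Plane → ℂ) =ᵐ[volume] fun y => -z ^ 2 * u y := by
    filter_upwards [AEEqFun.coeFn_sub (0 : Fn) (z ^ 2 • u), AEEqFun.coeFn_smul (z ^ 2) u,
      AEEqFun.coeFn_zero (β := ℂ) (μ := (volume : Measure Plane))] with x h1 h2 h3
    rw [h1, Pi.sub_apply, h2, h3]
    simp
  have e0 : MemWeightedL2 (-s) (0 : Fn) :=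
    (memWeightedL2_const hs 0).congr_ae AEEqFun.coeFn_zero.symm
  have e1 : resolventFun α Y z (0 - z ^ 2 • u : Fn) =
      resolventFun α Y z (fun y => -z ^ 2 * u y) := funext (resolventFun_congr_ae α Y z e)
  change weightedH α Y s z u 0 ↔ _
  rw [weightedH, extendedResolvent_iff (by linarith) hz, e1]
  exact ⟨fun h => ⟨h.1, h.2.2.2.2⟩, fun h => ⟨h.1, e0, (h.1.const_mul (-z ^ 2)).congr_ae e.symm,
    h.1, h.2⟩⟩

/-- A null vector is a potential with charges `a = Γ(z)⁻¹ b`, where `b_k = -z² (G * u)(y_k)`: the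
remainder after subtracting the logarithms is a fixed point of `-z² G *`, hence constant. -/
theorem exists_potential_of_mem_nullSpace (hs : 1 < s) (hs2 : s < 2) (hz : 0 < z.im)
    (α : Fin N → ℝ) {Y : Fin N → Plane} (hY : Function.Injective Y)
    (hΓ : (Gam α Y z).det ≠ 0) {u : Fn} (hu : u ∈ nullSpace α Y s z) :
    ∃ (c : ℂ) (a : Fin N → ℂ), (∀ k, (Dt α Y).mulVec a k = c) ∧ u =ᵐ[volume] potential Y c a := by
  obtain ⟨hu2, hu⟩ := (mem_nullSpace_iff hs hz α Y u).1 hu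
  have hs0 : 0 < s := by linarith
  have hG := weightedKernel_freeKernel hs0 hz
  set b : Fin N → ℂ := fun k => -z ^ 2 * conv (freeKernel z) u (Y k) with hb
  set a : Fin N → ℂ := (Gam α Y z)⁻¹.mulVec b with ha
  have hL := memWeightedL2_sum_logKernel hs Y a
  have hw : MemWeightedL2 (-s) (fun x => u x - ∑ j, a j * logKernel (x - Y j)) := hu2.sub hL
  obtain ⟨c, hc⟩ := exists_const_of_fixed hs0 hs2 hz hw (by
    filter_upwards [hu, ae_sub_ne_zero Y] with x hx hxY
    rw [resolventFun_neg_sq_mul] at hx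
    rw [conv_sub_right (hG.integrable_conv hs0.le hu2 x) (hG.integrable_conv hs0.le hL x), mul_sub,
      conv_freeKernel_sum_logKernel z hz]
    have h1 : ∀ j, -z ^ 2 * conv (freeKernel z) logKernel (x - Y j) =
      logKernel (x - Y j) - freeKernel z (x - Y j) := fun j => conv_freeKernel_logKernel hz (hxY j)
    simp only [h1, mul_sub, Finset.sum_sub_distrib]
    linear_combination hx)
  have hup : u =ᵐ[volume] potential Y c a := by
    filter_upwards [hc] with x hx
    rw [potential, ← hx]; ring
  refine ⟨c, a, fun k => ?_, hup⟩
  have h2 := conv_freeKernel_potential_site hz α hY c a k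
  rw [← conv_congr_ae hup] at h2
  have h3 : (Gam α Y z).mulVec a = b := by
    rw [ha, Matrix.mulVec_mulVec, Matrix.mul_nonsing_inv _ (isUnit_iff_ne_zero.2 hΓ),
      Matrix.one_mulVec]
  rw [h3] at h2
  change b k = _ at h2
  linear_combination h2

theorem mem_nullSpace_of_potential (hs : 1 < s) (hz : 0 < z.im) (α : Fin N → ℝ)
    {Y : Fin N → Plane} (hY : Function.Injective Y) (hΓ : (Gam α Y z).det ≠ 0) {u : Fn} {c : ℂ}
    {a : Fin N → ℂ} (ha : ∀ k, (Dt α Y).mulVec a k = c) (hu : u =ᵐ[volume] potential Y c a) :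
    u ∈ nullSpace α Y s z := by
  refine (mem_nullSpace_iff hs hz α Y u).2 ⟨
    (memWeightedL2_potential hs Y c a).congr_ae hu.symm, ?_⟩
  have h1 : (fun k => -z ^ 2 * conv (freeKernel z) u (Y k)) = (Gam α Y z).mulVec a := by
    ext k
    rw [conv_congr_ae hu, conv_freeKernel_potential_site hz α hY, ha k]
    ring
  filter_upwards [hu, ae_sub_ne_zero Y] with x hx hxY
  rw [resolventFun_neg_sq_mul, h1, Matrix.mulVec_mulVec,
    Matrix.nonsing_inv_mul _ (isUnit_iff_ne_zero.2 hΓ), Matrix.one_mulVec, conv_congr_ae hu,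
    conv_freeKernel_potential hz, hx, potential]
  have h2 : ∀ j, -z ^ 2 * conv (freeKernel z) logKernel (x - Y j) =
    logKernel (x - Y j) - freeKernel z (x - Y j) := fun j => conv_freeKernel_logKernel hz (hxY j)
  simp only [h2, mul_sub, Finset.sum_sub_distrib]
  ring

end

end PointInteraction

end

theorem lemma1p3 (N : ℕ) (hN : 1 ≤ N) (α : Fin N → ℝ) (Y : Fin N → PointInteraction.Plane)
    (hY : Function.Injective Y) (σ : ℝ) (hσ₁ : 1 < σ) (hσ₂ : σ < 2)
    (z : ℂ) (hz : 0 < z.im) (hΓ : (PointInteraction.Gam α Y z).det ≠ 0) :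
    PointInteraction.nullSpace α Y σ z =
      {φ | ∃ a : Fin N → ℂ,
        (PointInteraction.S N * PointInteraction.Dt α Y).mulVec a = 0 ∧
          φ = PointInteraction.phi α Y a} := by
  have hphi : ∀ a, PointInteraction.phi α Y a =ᵐ[volume] PointInteraction.potential Y
      ((∑ j, (PointInteraction.Dt α Y).mulVec a j) / (N : ℂ)) a := fun a => by
    rw [← PointInteraction.phiFun_eq_potential]
    exact AEEqFun.coeFn_mk _ _
  ext u
  simp only [Set.mem_ofPred_eq, PointInteraction.complement_mulVec_eq_zero_iff]
  constructor
  · intro hu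
    obtain ⟨c, a, ha, hua⟩ :=
      PointInteraction.exists_potential_of_mem_nullSpace hσ₁ hσ₂ hz α hY hΓ hu
    have hN0 : (N : ℂ) ≠ 0 := by exact_mod_cast (by omega : N ≠ 0)
    have hc : (∑ j, (PointInteraction.Dt α Y).mulVec a j) / (N : ℂ) = c := by
      simp [ha, hN0]
    refine ⟨a, fun k => by rw [hc, ha], AEEqFun.ext (hua.trans ?_)⟩
    have := (hphi a).symm
    rwa [hc] at this
  · rintro ⟨a, ha, rfl⟩
    exact PointInteraction.mem_nullSpace_of_potential hσ₁ hz α hY hΓ ha (hphi a)
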